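/- **Setting.** Let $n,d\ge 1$ and $m_1,\dots,m_n\ge 1$ be integers, $N=\sum_{i=1}^n m_i$, $\lambda\ge 0$, $\mu>0$. For $1\le i\le n$, $1\le j\le m_i$ let $f_{i,j}:\mathbb R^d\to\mathbb R$ be differentiable, convex and smooth with respect to a symmetric positive definite matrix $\mathbf M_{i,j}\in\mathbb R^{d\times d}$, i.e. $$f_{i,j}(y)+\langle\nabla f_{i,j}(y),x-y\rangle\le f_{i,j}(x)\le f_{i,j}(y)+\langle\nabla f_{i,j}(y),x-y\rangle+\tfrac12\|x-y\|^2_{\mathbf M_{i,j}}\qquad\forall x,y\in\mathbb R^d,$$ where $\|h\|_{\mathbf A}^2=\langle h,\mathbf A h\rangle$. Let each local objective $f_i=\frac nN\sum_{j=1}^{m_i}f_{i,j}$ be $\mu$-strongly convex, and let $R_i:\mathbb R^d\to\mathbb R\cup\{+\infty\}$ be proper, closed and convex. For $x=(x_1,\dots,x_n)\in(\mathbb R^d)^n$ and $\bar x=\frac1n\sum_i x_i$ consider $$\min_{x}\ \ \frac1N\sum_{i=1}^n\sum_{j=1}^{m_i}f_{i,j}(x_i)+\frac{\lambda}{2n}\sum_{i=1}^n\|x_i-\bar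 x\|^2+\sum_{i=1}^nR_i(x_i).\qquad(1)$$ Let $\mathcal D$ be a probability distribution on the subsets of $\{1,\dots,n\}$ and $\mathcal D_i$ one on the subsets of $\{1,\dots,m_i\}$. Put $p_i=\mathbb P(i\in C)$ for $C\sim\mathcal D$ and $p_{i,j}=\mathbb P(j\in S_i)$ for $S_i\sim\mathcal D_i$, and assume that all $p_i$, $p_{i,j}$ are positive. Let $v_{i,j}\in\mathbb R$ satisfy, for every $i$ and all $h_1,\dots,h_{m_i}\in\mathbb R^d$, $$\mathbb E\Big\|\sum_{j\in S_i}\mathbf M_{i,j}^{1/2}h_j\Big\|^2\le\sum_{j=1}^{m_i}p_{i,j}v_{i,j}\|h_j\|^2 .$$ Let $0<p<1$ and $0<\rho_i\le 1$. **Algorithm (L2SGD++, L-SVRG option, stepsize $\alpha$).** Start from any $x^0\in(\mathbb R^d)^n$, $J^0_{i,j}=0$, $\Psi^0_i=0$. In iteration $k$ draw afresh and independently $\xi\in\{0,1\}$ with $\mathbb P(\xi=1)=p$, $C\sim\mathcal D$, $S_i\sim\mathcal D_i$ and $b_i\in\{0,1\}$ with $\mathbb P(b_i=1)=\rho_i$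 ($1\le i\le n$). * If $\xi=0$ and $i\in C$: $\ g_i^k=\frac{1}{N(1-p)p_i}\sum_{j\in S_i}\frac{1}{p_{i,j}}\big(\nabla f_{i,j}(x_i^k)-J_{i,j}^k\big)+\frac1N\sum_jJ^k_{i,j}+\frac1n\Psi_i^k$, $\ \Psi_i^{k+1}=\Psi_i^k$, and $J^{k+1}_{i,j}=\nabla f_{i,j}(x_i^k)$ for all $j$ if $b_i=1$, $J^{k+1}_{i,j}=J^k_{i,j}$ for all $j$ if $b_i=0$. * If $\xi=0$ and $i\notin C$: $\ g_i^k=\frac1N\sum_jJ^k_{i,j}+\frac1n\Psi_i^k$, $\ J_{i,j}^{k+1}=J_{i,j}^k$, $\ \Psi_i^{k+1}=\Psi_i^k$. * If $\xi=1$, for all $i$: $\ g_i^k=\frac{\lambda}{np}(x_i^k-\bar x^k)-\frac{p^{-1}-1}{n}\Psi_i^k+\frac1N\sum_jJ_{i,j}^k$, $\ \Psi_i^{k+1}=\lambda(x_i^k-\bar x^k)$, $\ J_{i,j}^{k+1}=J_{i,j}^k$. In all cases $x_i^{k+1}=\operatorname{prox}_{\alpha R_i}(x_i^k-\alpha g_i^k)$,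 where $\operatorname{prox}_{\alpha R_i}(z)=\arg\min_u\{\alpha R_i(u)+\frac12\|u-z\|^2\}$. **Theorem.** Let $$\alpha=\min\left\{\min_{i,j}\frac{N(1-p)p_i}{4\frac{v_{i,j}}{p_{i,j}}+N\frac{\mu}{n}\rho_i^{-1}},\ \frac{np}{4\lambda+\mu}\right\}.$$ Then $\alpha>0$, problem (1) has a unique minimizer $x^\star$, and with $$\Phi^k=\|x^k-x^\star\|^2+\alpha\sum_{i=1}^n\frac{1}{2N(1-p)\rho_ip_i}\sum_{j=1}^{m_i}\big\|J^k_{i,j}-\nabla f_{i,j}(x_i^\star)\big\|^2_{\mathbf M_{i,j}^{-1}}+\frac{\alpha}{2pn\lambda}\sum_{i=1}^n\big\|\Psi_i^k-\lambda(x_i^\star-\bar x^\star)\big\|^2$$ (the last term is absent if $\lambda=0$) we have $\mathbb E[\Phi^k]\le(1-\frac{\alpha\mu}{n})^k\,\Phi^0$ for all $k\ge0$. Consequently the iteration complexity is $$\max\left\{\max_{i,j}\frac{4v_{i,j}\frac{n}{Np_{i,j}}+\mu\rho_i^{-1}}{p_i\mu(1-p)},\ \frac{4\lambda+\mu}{p\mu}\right\}\log\frac1\varepsilon,$$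 that is, for every $\varepsilon\in(0,1)$ and every integer $k$ at least as large as this number, $\mathbb E[\Phi^k]\le\varepsilon\,\Phi^0$, and in particular $\mathbb E\|x^k-x^\star\|^2\le\varepsilon\,\Phi^0$. -/

import Mathlib

open scoped MatrixOrder

namespace L2SGD

/-- The space `ℝ^d` with its Euclidean norm. -/
abbrev Vec (d : ℕ) : Type := EuclideanSpace ℝ (Fin d)

/-- The quadratic form `‖h‖²_A = ⟨h, A h⟩`. -/
noncomputable def quadForm {d : ℕ} (A : Matrix (Fin d) (Fin d) ℝ) (h : Vec d) : ℝ :=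
  inner ℝ h (Matrix.toEuclideanLin A h)

/-- The function `g` is differentiable, convex and smooth with respect to the matrix `M`:
`g y + ⟨∇g y, x - y⟩ ≤ g x ≤ g y + ⟨∇g y, x - y⟩ + (1/2) ‖x - y‖²_M`. -/
def ConvexMatrixSmooth {d : ℕ} (M : Matrix (Fin d) (Fin d) ℝ) (g : Vec d → ℝ) : Prop :=
  Differentiable ℝ g ∧ ∀ x y : Vec d,
    g y + inner ℝ (gradient g y) (x - y) ≤ g x ∧
    g x ≤ g y + inner ℝ (gradient g y) (x - y) + 1 / 2 * quadForm M (x - y)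

/-- `r : ℝ^d → ℝ ∪ {+∞}`, given by its effective domain `D` and its finite values on `D`,
is proper, convex and closed (that is, its epigraph is closed). -/
def ProperClosedConvex {d : ℕ} (D : Set (Vec d)) (r : Vec d → ℝ) : Prop :=
  D.Nonempty ∧ ConvexOn ℝ D r ∧ IsClosed {q : Vec d × ℝ | q.1 ∈ D ∧ r q.1 ≤ q.2}

/-- `u` minimizes `a r(u) + (1/2) ‖u - z‖²`, where `r = +∞` outside `D`. -/
def IsProxPoint {d : ℕ} (a : ℝ) (D : Set (Vec d)) (r : Vec d → ℝ) (z u : Vec d) : Prop :=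
  u ∈ D ∧ ∀ w ∈ D, a * r u + 1 / 2 * ‖u - z‖ ^ 2 ≤ a * r w + 1 / 2 * ‖w - z‖ ^ 2

/-- The proximal operator `prox_{a r}(z) = argmin_u { a r(u) + (1/2) ‖u - z‖² }`. -/
noncomputable def prox {d : ℕ} (a : ℝ) (D : Set (Vec d)) (r : Vec d → ℝ) (z : Vec d) : Vec d :=
  Classical.epsilon (IsProxPoint a D r z)

/-- The average of the local models. -/
noncomputable def average {n d : ℕ} (x : Fin n → Vec d) : Vec d := (1 / (n : ℝ)) • ∑ i, x i

/-- The data of the problem and of the method, with `n` clients, dimension `d`, and `m i` data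
points on client `i`. The regularizer of client `i` equals `reg i` on `dom i` and `+∞` elsewhere. -/
structure Data (n d : ℕ) (m : Fin n → ℕ) where
  /-- the losses `f_{i,j}` -/
  loss : ∀ i, Fin (m i) → Vec d → ℝ
  /-- the effective domains of the regularizers -/
  dom : Fin n → Set (Vec d)
  /-- the finite values of the regularizers -/
  reg : Fin n → Vec d → ℝ
  /-- the penalty parameter `λ` -/
  lam : ℝ
  /-- the law of the random set of active clients -/
  clients : PMF (Finset (Fin n))
  /-- the law of the random set of indices sampled by each client -/
  batch : ∀ i, PMF (Finset (Fin (m i)))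
  /-- the aggregation probability `p` -/
  pAgg : ℝ
  /-- the probabilities `ρ_i` of refreshing the local control variates -/
  rho : Fin n → ℝ

/-- Local models `x`, tables `J` of local gradients, and control variates `Psi` of the penalty. -/
structure State (n d : ℕ) (m : Fin n → ℕ) where
  x : Fin n → Vec d
  J : ∀ i, Fin (m i) → Vec d
  Psi : Fin n → Vec d

/-- The random choices of one iteration: the aggregation coin `ξ`, the set of active clients, the
local samples `S_i`, and one refreshing coin per client. Choices that an iteration does not use
are drawn and ignored. -/
abbrev Draw (n : ℕ) (m : Fin n → ℕ) : Type :=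
  Bool × Finset (Fin n) × (∀ i, Finset (Fin (m i))) × (Fin n → Bool)

namespace Data

variable {n d : ℕ} {m : Fin n → ℕ} (P : Data n d m)

/-- The total number `N` of data points. -/
def total (_ : Data n d m) : ℕ := ∑ i, m i

/-- The local objective `f_i = (n / N) ∑_j f_{i,j}`. -/
noncomputable def localLoss (i : Fin n) (z : Vec d) : ℝ :=
  (n : ℝ) / (P.total : ℝ) * ∑ j, P.loss i j z

/-- The objective
`(1/N) ∑_i ∑_j f_{i,j}(x_i) + λ (1/(2n)) ∑_i ‖x_i - x̄‖² + ∑_i R_i(x_i)`, on the domain of `R`. -/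
noncomputable def objective (x : Fin n → Vec d) : ℝ :=
  1 / (P.total : ℝ) * ∑ i, ∑ j, P.loss i j (x i)
    + P.lam * (1 / (2 * (n : ℝ)) * ∑ i, ‖x i - average x‖ ^ 2)
    + ∑ i, P.reg i (x i)

/-- `x` minimizes the objective over `(ℝ^d)^n`. -/
def IsSolution (x : Fin n → Vec d) : Prop :=
  (∀ i, x i ∈ P.dom i) ∧
    ∀ y : Fin n → Vec d, (∀ i, y i ∈ P.dom i) → P.objective x ≤ P.objective y

/-- The probability `p_i` that client `i` is active. -/
noncomputable def pClient (i : Fin n) : ℝ :=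
  ∑ C : Finset (Fin n), if i ∈ C then (P.clients C).toReal else 0

/-- The probability `p_{i,j}` that client `i` samples the index `j`. -/
noncomputable def pIndex (i : Fin n) (j : Fin (m i)) : ℝ :=
  ∑ S : Finset (Fin (m i)), if j ∈ S then (P.batch i S).toReal else 0

/-- Expected separable overapproximation: for every client `i` and all vectors `h_j`,
`E ‖∑_{j ∈ S_i} M_{i,j}^{1/2} h_j‖² ≤ ∑_j p_{i,j} v_{i,j} ‖h_j‖²`. -/
def ESO (M : ∀ i, Fin (m i) → Matrix (Fin d) (Fin d) ℝ) (v : ∀ i, Fin (m i) → ℝ) : Prop :=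
  ∀ (i : Fin n) (h : Fin (m i) → Vec d),
    ∑ S : Finset (Fin (m i)), (P.batch i S).toReal *
        ‖∑ j ∈ S, Matrix.toEuclideanLin (CFC.sqrt (M i j)) (h j)‖ ^ 2
      ≤ ∑ j, P.pIndex i j * v i j * ‖h j‖ ^ 2

/-- The probability of the random choices `w` of one iteration; all of them are independent. -/
noncomputable def drawProb (w : Draw n m) : ℝ :=
  (if w.1 then P.pAgg else 1 - P.pAgg) * (P.clients w.2.1).toReal
    * (∏ i, (P.batch i (w.2.2.1 i)).toReal)
    * ∏ i, (if w.2.2.2 i then P.rho i else 1 - P.rho i)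

/-- The gradient estimator `g` of one iteration. -/
noncomputable def estimator (s : State n d m) (w : Draw n m) (i : Fin n) : Vec d :=
  if w.1 then
    (P.lam / ((n : ℝ) * P.pAgg)) • (s.x i - average s.x)
      - ((P.pAgg⁻¹ - 1) / (n : ℝ)) • s.Psi i
      + (1 / (P.total : ℝ)) • ∑ j, s.J i j
  else if i ∈ w.2.1 then
    (1 / ((P.total : ℝ) * (1 - P.pAgg) * P.pClient i)) •
        ∑ j ∈ w.2.2.1 i, (P.pIndex i j)⁻¹ • (gradient (P.loss i j) (s.x i) - s.J i j)
      + (1 / (P.total : ℝ)) • ∑ j, s.J i j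
      + (1 / (n : ℝ)) • s.Psi i
  else
    (1 / (P.total : ℝ)) • ∑ j, s.J i j + (1 / (n : ℝ)) • s.Psi i

/-- One iteration of L2SGD++ (L-SVRG option) with stepsize `α` and random choices `w`. -/
noncomputable def step (α : ℝ) (s : State n d m) (w : Draw n m) : State n d m where
  x := fun i => prox α (P.dom i) (P.reg i) (s.x i - α • P.estimator s w i)
  J := fun i j =>
    if w.1 = false ∧ i ∈ w.2.1 ∧ w.2.2.2 i = true then gradient (P.loss i j) (s.x i) else s.J i j
  Psi := fun i => if w.1 then P.lam • (s.x i - average s.x) else s.Psi i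

/-- The initial state: local models `x0` and zero control variates. -/
noncomputable def start (_ : Data n d m) (x0 : Fin n → Vec d) : State n d m :=
  ⟨x0, fun _ _ => 0, fun _ => 0⟩

/-- The state after `k` iterations with random choices `ω 0, …, ω (k - 1)`, started from the local
models `x0`. -/
noncomputable def run (α : ℝ) (x0 : Fin n → Vec d) :
    (k : ℕ) → (Fin k → Draw n m) → State n d m
  | 0, _ => P.start x0
  | k + 1, ω => P.step α (run α x0 k (fun t => ω t.castSucc)) (ω (Fin.last k))

/-- The expectation of `φ` at the random state after `k` iterations; the random choices of
different iterations are independent. -/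
noncomputable def expect (α : ℝ) (x0 : Fin n → Vec d) (k : ℕ) (φ : State n d m → ℝ) : ℝ :=
  ∑ ω : Fin k → Draw n m, (∏ t, P.drawProb (ω t)) * φ (P.run α x0 k ω)

/-- The stepsize
`min { min_{i,j} N (1-p) p_i / (4 v_{i,j} / p_{i,j} + N (μ/n) / ρ_i), n p / (4λ + μ) }`. -/
noncomputable def stepsize (μ : ℝ) (v : ∀ i, Fin (m i) → ℝ) : ℝ :=
  min
    (⨅ a : (i : Fin n) × Fin (m i),
      ((P.total : ℝ) * (1 - P.pAgg) * P.pClient a.1) /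
        (4 * (v a.1 a.2 / P.pIndex a.1 a.2)
          + (P.total : ℝ) * (μ / (n : ℝ)) * (P.rho a.1)⁻¹))
    (P.pAgg * (n : ℝ) / (4 * P.lam + μ))

/-- The factor of `log (1/ε)` in the iteration complexity,
`max { max_{i,j} (4 v_{i,j} n / (N p_{i,j}) + μ / ρ_i) / (p_i μ (1-p)), (4λ + μ) / (p μ) }`. -/
noncomputable def complexity (μ : ℝ) (v : ∀ i, Fin (m i) → ℝ) : ℝ :=
  max
    (⨆ a : (i : Fin n) × Fin (m i),
      (4 * v a.1 a.2 * ((n : ℝ) / ((P.total : ℝ) * P.pIndex a.1 a.2)) + μ * (P.rho a.1)⁻¹) /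
        (P.pClient a.1 * μ * (1 - P.pAgg)))
    ((4 * P.lam + μ) / (P.pAgg * μ))

/-- The squared distance `∑_i ‖x_i - x⋆_i‖²` of the local models to `xs`. -/
noncomputable def sqDist (xs : Fin n → Vec d) (s : State n d m) : ℝ := ∑ i, ‖s.x i - xs i‖ ^ 2

/-- The Lyapunov function: squared distance to `xs` plus the weighted squared errors of the
control variates. (For `λ = 0` the last coefficient is `0`, and then `Psi` stays `0`.) -/
noncomputable def lyapunov (M : ∀ i, Fin (m i) → Matrix (Fin d) (Fin d) ℝ) (α : ℝ)
    (xs : Fin n → Vec d) (s : State n d m) : ℝ :=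
  sqDist xs s
    + α * (∑ i, 1 / (2 * (P.total : ℝ) * (1 - P.pAgg) * P.rho i * P.pClient i) *
          ∑ j, quadForm (M i j)⁻¹ (s.J i j - gradient (P.loss i j) (xs i))
        + 1 / (2 * P.pAgg * (n : ℝ) * P.lam) *
          ∑ i, ‖s.Psi i - P.lam • (xs i - average xs)‖ ^ 2)

end Data

end L2SGD

/-!
The estimator is a variance-reduced stochastic gradient of the smooth part of the objective. Fix a
client `i`, and let `sampled i a u` be its unbiased sample of `(1/N) ∑_j a_j + (1/n) u`: a multiple
of `u` in an aggregation step, an importance-weighted sum of the sampled `a_j` in a local step. With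
`a`, `u` the changes of the gradients of `f_{i,j}` and of the penalty between `x⋆` and `x`, and `b`,
`w` the errors of the control variates `J`, `Psi`, the estimator minus the gradient at `x⋆` is
`sampled i a u - (sampled i b w - E (sampled i b w))` (`estimator_sub_smoothGradient`). Subtracting
a mean does not increase the second moment, so this error costs at most
`2 E ‖sampled i a u‖² + 2 E ‖sampled i b w‖²` (`sum_mul_norm_step_sq_le`). Aggregation and local
steps exclude each other, so the two parts of `sampled` have no cross term, and the separable
overapproximation, applied to `M_{i,j}^{-1/2} a_j / p_{i,j}`, bounds each second moment by
`M_{i,j}⁻¹`-norms (`sum_drawProb_mul_norm_sampled_sq_le`).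

A solution `x⋆` satisfies a variational inequality, hence a proximal step does not increase
distances to it (`norm_prox_sub_le`). In the expansion of the squared distance, the inner product
with the gradient change is a sum of two Bregman divergences: cocoercivity turns one into the
`M_{i,j}⁻¹`-norms of `a_j`, strong convexity turns the other into `μ / (2n) ‖x_i - x⋆_i‖²`
(`le_inner_sum_gradient_sub`). The quadratic penalty contributes `‖u‖² / (n λ)`, after summation
over the clients. The weights in the Lyapunov function and the stepsize are such that these gains
pay for the second moments and for the refreshed control variates, so that one iteration contracts
the mean of the Lyapunov function by `1 - α μ / n` (`sum_drawProb_mul_lyapunov_step_le`). The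
complexity constant is `n / (α μ)`, and `1 - t ≤ exp (-t)`.

Existence of the minimizer and of proximal points comes from `exists_min_of_strongConvexOn`. All
first-order conditions are obtained by comparing values along short segments, where smoothness gives
a quadratic upper model.
-/

namespace L2SGD

open Filter Topology

/-! ### Minimizers of strongly convex, lower semicontinuous functions -/

/-- The function equal to `g` on `D` and to `+∞` elsewhere is lower semicontinuous. The values of
`g` outside `D` play no role: a bound `c` at `x ∉ D` is unrestricted, so that `g` has to tend to
`+∞` along points of `D` that approach `x`. -/
def LscExtension {E : Type*} [TopologicalSpace E] (D : Set E) (g : E → ℝ) : Prop :=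
  ∀ (x : E) (c : ℝ), (x ∈ D → c < g x) → ∀ᶠ y in 𝓝 x, y ∈ D → c < g y

lemma LscExtension.isClosed_sublevel {E : Type*} [TopologicalSpace E] {D : Set E} {g : E → ℝ}
    (h : LscExtension D g) (t : ℝ) : IsClosed {x | x ∈ D ∧ g x ≤ t} := by
  rw [← isOpen_compl_iff, isOpen_iff_mem_nhds]
  intro x hx
  have hx' : x ∈ D → t < g x := fun hD => not_le.1 fun hle => hx ⟨hD, hle⟩
  filter_upwards [h x t hx'] with y hy hmem
  exact absurd hmem.2 (not_le.2 (hy hmem.1))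

lemma LscExtension.lowerSemicontinuousOn {E : Type*} [TopologicalSpace E] {D : Set E} {g : E → ℝ}
    (h : LscExtension D g) {K : Set E} (hK : K ⊆ D) : LowerSemicontinuousOn g K := by
  intro x _ c hc
  filter_upwards [mem_nhdsWithin_of_mem_nhds (h x c fun _ => hc), self_mem_nhdsWithin] with y hy hyK
  exact hy (hK hyK)

lemma ProperClosedConvex.lscExtension {d : ℕ} {D : Set (Vec d)} {r : Vec d → ℝ}
    (h : ProperClosedConvex D r) : LscExtension D r := by
  intro x c hc
  have hx : (x, c) ∈ {q : Vec d × ℝ | q.1 ∈ D ∧ r q.1 ≤ q.2}ᶜ := fun hq =>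
    absurd hq.2 (not_le.2 (hc hq.1))
  -- the complement of the closed epigraph is open, and `y ↦ (y, c)` is continuous
  have hcont : Continuous fun y : Vec d => (y, c) := by fun_prop
  filter_upwards [hcont.continuousAt.preimage_mem_nhds (h.2.2.isOpen_compl.mem_nhds hx)]
    with y hy hD
  exact not_le.1 fun hle => hy ⟨hD, hle⟩

lemma LscExtension.const_mul_add {E : Type*} [TopologicalSpace E] {D : Set E} {g φ : E → ℝ}
    (h : LscExtension D g) {a : ℝ} (ha : 0 < a) (hφ : Continuous φ) :
    LscExtension D fun x => a * g x + φ x := by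
  intro x c hc
  -- a margin `δ` is split off so that `φ` may drop by `δ` near `x`
  obtain ⟨δ, hδ, hδ'⟩ : ∃ δ : ℝ, 0 < δ ∧ (x ∈ D → (c + δ - φ x) / a < g x) := by
    by_cases hx : x ∈ D
    · refine ⟨(a * g x + φ x - c) / 2, by linarith [hc hx], fun _ => ?_⟩
      rw [div_lt_iff₀ ha]
      nlinarith [hc hx]
    · exact ⟨1, one_pos, fun hx' => absurd hx' hx⟩
  filter_upwards [h x _ hδ', hφ.continuousAt.eventually (lt_mem_nhds (sub_lt_self (φ x) hδ))]
    with y hy hy' hyD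
  have := hy hyD
  rw [div_lt_iff₀ ha] at this
  have hφy : φ x - δ < φ y := hy'
  change c < a * g y + φ y
  linarith

lemma LscExtension.sum_pi {ι E : Type*} [Fintype ι] [TopologicalSpace E] {D : ι → Set E}
    {g : ι → E → ℝ} (h : ∀ i, LscExtension (D i) (g i)) :
    LscExtension {x : ι → E | ∀ i, x i ∈ D i} fun x => ∑ i, g i (x i) := by
  classical
  intro x c hc
  suffices H : ∃ a : ι → ℝ, (∀ i, x i ∈ D i → a i < g i (x i)) ∧ c < ∑ i, a i by
    obtain ⟨a, ha, hca⟩ := H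
    have hev : ∀ᶠ y : ι → E in 𝓝 x, ∀ i, y i ∈ D i → a i < g i (y i) :=
      eventually_all.2 fun i => (continuous_apply i).continuousAt.eventually (h i _ _ (ha i))
    filter_upwards [hev] with y hy hyD
    exact hca.trans_le (Finset.sum_le_sum fun i _ => (hy i (hyD i)).le)
  by_cases hx : ∀ i, x i ∈ D i
  · -- every summand gives up the same share of the gap
    have hc' := hc hx
    set δ : ℝ := (∑ i, g i (x i) - c) / (Fintype.card ι + 1) with hδ
    have hpos : (0 : ℝ) < Fintype.card ι + 1 := by positivity
    have hδ0 : 0 < δ := div_pos (by simpa using hc') hpos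
    refine ⟨fun i => g i (x i) - δ, fun i _ => by linarith, ?_⟩
    have hmul : δ * (Fintype.card ι + 1) = ∑ i, g i (x i) - c := by
      rw [hδ]; field_simp
    simp only [Finset.sum_sub_distrib, Finset.sum_const, Finset.card_univ, nsmul_eq_mul]
    nlinarith
  · -- one summand is `+∞` at `x`, and compensates the others
    push Not at hx
    obtain ⟨i₀, hi₀⟩ := hx
    refine ⟨fun i => if i = i₀ then c + 1 - ∑ j ∈ Finset.univ.erase i₀, (g j (x j) - 1)
      else g i (x i) - 1, fun i hi => ?_, ?_⟩
    · have : i ≠ i₀ := fun e => hi₀ (e ▸ hi)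
      simp [this]
    · rw [← Finset.add_sum_erase _ _ (Finset.mem_univ i₀)]
      have : ∑ i ∈ Finset.univ.erase i₀, (if i = i₀ then
          c + 1 - ∑ j ∈ Finset.univ.erase i₀, (g j (x j) - 1) else g i (x i) - 1)
          = ∑ i ∈ Finset.univ.erase i₀, (g i (x i) - 1) :=
        Finset.sum_congr rfl fun i hi => by simp [Finset.ne_of_mem_erase hi]
      rw [this]
      simp

/-- A strongly convex, lower semicontinuous function on a proper space attains its minimum: its
lower bound on a unit ball forces quadratic growth, so that its sublevel sets are compact. -/
lemma exists_min_of_strongConvexOn {E : Type*} [NormedAddCommGroup E] [NormedSpace ℝ E]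
    [ProperSpace E] {D : Set E} {g : E → ℝ} {μ : ℝ} (hμ : 0 < μ) (hD : D.Nonempty)
    (hg : StrongConvexOn D μ g) (hl : LscExtension D g) :
    ∃ x ∈ D, ∀ y ∈ D, g x ≤ g y := by
  obtain ⟨x₀, hx₀⟩ := hD
  set L := {x | x ∈ D ∧ g x ≤ g x₀} with hL
  have hLc : IsClosed L := hl.isClosed_sublevel _
  have hLD : L ⊆ D := fun x hx => hx.1
  have hx₀L : x₀ ∈ L := ⟨hx₀, le_rfl⟩
  have hK : IsCompact (L ∩ Metric.closedBall x₀ 1) :=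
    (isCompact_closedBall x₀ 1).inter_left hLc
  have hne : (L ∩ Metric.closedBall x₀ 1).Nonempty :=
    ⟨x₀, hx₀L, Metric.mem_closedBall_self zero_le_one⟩
  obtain ⟨z, -, hz⟩ := LowerSemicontinuousOn.exists_isMinOn hne hK
    (hl.lowerSemicontinuousOn (Set.inter_subset_left.trans hLD))
  -- a point of `L` at distance `t > 1` from `x₀` is compared with the point at distance `1` on the
  -- segment to `x₀`, where `g` is at least `g z`
  have hbd : L ⊆ Metric.closedBall x₀ (max 1 (1 + 2 * (g x₀ - g z) / μ)) := by
    intro x hx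
    rw [Metric.mem_closedBall, dist_eq_norm]
    by_cases h1 : ‖x - x₀‖ ≤ 1
    · exact h1.trans (le_max_left _ _)
    push Not at h1
    refine le_trans ?_ (le_max_right _ _)
    set t := ‖x - x₀‖ with ht
    have ht0 : 0 < t := by linarith
    have hti : 0 ≤ t⁻¹ := by positivity
    have hti1 : t⁻¹ ≤ 1 := inv_le_one_of_one_le₀ h1.le
    have hconv := hg.2 hx.1 hx₀ hti (sub_nonneg.2 hti1) (by ring)
    have hyD : t⁻¹ • x + (1 - t⁻¹) • x₀ ∈ D := hg.1 hx.1 hx₀ hti (sub_nonneg.2 hti1) (by ring)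
    simp only [smul_eq_mul, ← ht] at hconv
    have he : t⁻¹ * (1 - t⁻¹) * (μ / 2 * t ^ 2) = μ / 2 * (t - 1) := by field_simp
    rw [he] at hconv
    have hgap : 0 ≤ μ / 2 * (t - 1) := by nlinarith
    have hle : t⁻¹ * g x + (1 - t⁻¹) * g x₀ ≤ g x₀ := by nlinarith [hx.2]
    have hy1 : t⁻¹ • x + (1 - t⁻¹) • x₀ ∈ L ∩ Metric.closedBall x₀ 1 := by
      refine ⟨⟨hyD, by linarith⟩, ?_⟩
      rw [Metric.mem_closedBall, dist_eq_norm]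
      have : t⁻¹ • x + (1 - t⁻¹) • x₀ - x₀ = t⁻¹ • (x - x₀) := by module
      rw [this, norm_smul, Real.norm_of_nonneg hti, ← ht, inv_mul_cancel₀ ht0.ne']
    have hzy : g z ≤ g (t⁻¹ • x + (1 - t⁻¹) • x₀) := hz hy1
    have : t - 1 ≤ 2 * (g x₀ - g z) / μ := by
      rw [le_div_iff₀ hμ]; nlinarith
    linarith
  have hLk : IsCompact L := (isCompact_closedBall _ _).of_isClosed_subset hLc hbd
  have hLne : L.Nonempty := ⟨x₀, hx₀L⟩
  obtain ⟨x, hxL, hx⟩ := LowerSemicontinuousOn.exists_isMinOn hLne hLk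
    (hl.lowerSemicontinuousOn hLD)
  refine ⟨x, hxL.1, fun y hy => ?_⟩
  by_cases hyL : g y ≤ g x₀
  · exact hx ⟨hy, hyL⟩
  · exact hxL.2.trans (not_le.1 hyL).le

/-! ### The proximal operator -/

/-- The first-order coefficient of a quadratic that is nonnegative near `0⁺` is nonnegative. This
turns minimality along segments into variational inequalities. -/
lemma nonneg_of_quadratic_nonneg {a b : ℝ}
    (h : ∀ t : ℝ, 0 < t → t < 1 → 0 ≤ t * a + t ^ 2 * b) : 0 ≤ a := by
  have hlim : Tendsto (fun t : ℝ => a + t * b) (𝓝[>] 0) (𝓝 a) := by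
    have : Continuous fun t : ℝ => a + t * b := by fun_prop
    simpa using (this.tendsto 0).mono_left nhdsWithin_le_nhds
  refine ge_of_tendsto hlim ?_
  filter_upwards [Ioo_mem_nhdsGT (zero_lt_one' ℝ)] with t ht
  have := h t ht.1 ht.2
  exact nonneg_of_mul_nonneg_right (a := t) (by nlinarith) ht.1

lemma strongConvexOn_half_norm_sub_sq {E : Type*} [NormedAddCommGroup E] [InnerProductSpace ℝ E]
    (z : E) : StrongConvexOn Set.univ 1 fun u : E => 1 / 2 * ‖u - z‖ ^ 2 := by
  refine ⟨convex_univ, fun x _ y _ a b _ _ hab => le_of_eq ?_⟩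
  obtain rfl : b = 1 - a := by linarith
  have h1 : a • x + (1 - a) • y - z = a • (x - z) + (1 - a) • (y - z) := by module
  have h2 : x - y = (x - z) - (y - z) := by abel
  simp only [smul_eq_mul]
  rw [h1, h2]
  simp only [← real_inner_self_eq_norm_sq, inner_add_left, inner_add_right,
    inner_sub_left, inner_sub_right, real_inner_smul_left, real_inner_smul_right]
  ring

lemma exists_isProxPoint {d : ℕ} {D : Set (Vec d)} {r : Vec d → ℝ} (h : ProperClosedConvex D r)
    {a : ℝ} (ha : 0 < a) (z : Vec d) : ∃ u, IsProxPoint a D r z u := by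
  have hcv : StrongConvexOn D 1 fun u => a * r u + 1 / 2 * ‖u - z‖ ^ 2 := by
    have h1 := (strongConvexOn_half_norm_sub_sq z)
    refine ⟨h.2.1.1, fun x hx y hy s t hs ht hst => ?_⟩
    have h2 := h1.2 (Set.mem_univ x) (Set.mem_univ y) hs ht hst
    have h3 := h.2.1.2 hx hy hs ht hst
    simp only [smul_eq_mul] at h2 h3 ⊢
    nlinarith
  obtain ⟨u, hu, hmin⟩ := exists_min_of_strongConvexOn one_pos h.1 hcv
    (h.lscExtension.const_mul_add ha (by fun_prop))
  exact ⟨u, hu, hmin⟩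

lemma isProxPoint_prox {d : ℕ} {D : Set (Vec d)} {r : Vec d → ℝ} (h : ProperClosedConvex D r)
    {a : ℝ} (ha : 0 < a) (z : Vec d) : IsProxPoint a D r z (prox a D r z) :=
  Classical.epsilon_spec (exists_isProxPoint h ha z)

lemma IsProxPoint.variational {d : ℕ} {D : Set (Vec d)} {r : Vec d → ℝ} {a : ℝ} {z u : Vec d}
    (hu : IsProxPoint a D r z u) (hr : ConvexOn ℝ D r) (ha : 0 < a) {w : Vec d} (hw : w ∈ D) :
    a * r u + inner ℝ (z - u) (w - u) ≤ a * r w := by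
  suffices H : 0 ≤ a * (r w - r u) - inner ℝ (z - u) (w - u) by linarith
  refine nonneg_of_quadratic_nonneg (b := 1 / 2 * ‖w - u‖ ^ 2) fun t ht0 ht1 => ?_
  have hmem : (1 - t) • u + t • w ∈ D := hr.1 hu.1 hw (by linarith) ht0.le (by ring)
  have h1 := hu.2 _ hmem
  have h2 := hr.2 hu.1 hw (sub_nonneg.2 ht1.le) ht0.le (by ring)
  simp only [smul_eq_mul] at h2
  have h3 : (1 - t) • u + t • w - z = t • (w - u) - (z - u) := by module
  rw [h3, norm_sub_sq_real (t • (w - u)), norm_smul, real_inner_smul_left, mul_pow,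
    norm_sub_rev u z, real_inner_comm, Real.norm_of_nonneg ht0.le] at h1
  nlinarith [mul_le_mul_of_nonneg_left h2 ha.le]

/-- If `xs` solves the inclusion `-g ∈ ∂r(xs)`, a proximal step from `z` comes at least as
close to `xs` as `z` is to `xs - α g`, the point that the proximal operator maps to `xs`. -/
lemma norm_prox_sub_le {d : ℕ} {D : Set (Vec d)} {r : Vec d → ℝ} (h : ProperClosedConvex D r)
    {α : ℝ} (hα : 0 < α) {xs g : Vec d} (hxs : xs ∈ D)
    (hg : ∀ w ∈ D, 0 ≤ inner ℝ g (w - xs) + (r w - r xs)) (z : Vec d) :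
    ‖prox α D r z - xs‖ ≤ ‖z - (xs - α • g)‖ := by
  set u := prox α D r z with hu
  have hprox := isProxPoint_prox h hα z
  have h1 := hprox.variational h.2.1 hα hxs
  have h2 := mul_le_mul_of_nonneg_left (hg u hprox.1) hα.le
  rw [← hu] at h1
  have h3 : inner ℝ (z - (xs - α • g)) (u - xs)
      = ‖u - xs‖ ^ 2 + α * inner ℝ g (u - xs) - inner ℝ (z - u) (xs - u) := by
    rw [show z - (xs - α • g) = (z - u) + (u - xs) + α • g by abel, inner_add_left,
      inner_add_left, real_inner_self_eq_norm_sq, real_inner_smul_left, ← neg_sub u xs,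
      inner_neg_right]
    ring
  have h4 := real_inner_le_norm (z - (xs - α • g)) (u - xs)
  have h5 : ‖u - xs‖ ^ 2 ≤ ‖z - (xs - α • g)‖ * ‖u - xs‖ := by nlinarith
  rcases (norm_nonneg (u - xs)).eq_or_lt with h0 | h0
  · rw [← h0]; positivity
  · exact le_of_mul_le_mul_right (by linarith [sq (‖u - xs‖)]) h0

/-! ### Matrix smoothness -/

section MatrixSmooth

variable {d : ℕ} {A : Matrix (Fin d) (Fin d) ℝ}

lemma toEuclideanLin_mul (A B : Matrix (Fin d) (Fin d) ℝ) (h : Vec d) :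
    Matrix.toEuclideanLin (A * B) h = Matrix.toEuclideanLin A (Matrix.toEuclideanLin B h) := by
  simp [Matrix.toLpLin_apply]

lemma toEuclideanLin_one (h : Vec d) :
    Matrix.toEuclideanLin (1 : Matrix (Fin d) (Fin d) ℝ) h = h := by
  simp

lemma inner_toEuclideanLin_comm (hA : A.IsHermitian) (g h : Vec d) :
    inner ℝ (Matrix.toEuclideanLin A g) h = inner ℝ g (Matrix.toEuclideanLin A h) :=
  Matrix.isSymmetric_toEuclideanLin_iff.2 hA g h

lemma quadForm_nonneg (hA : A.PosSemidef) (h : Vec d) : 0 ≤ quadForm A h := by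
  have := (Matrix.isPositive_toEuclideanLin_iff.2 hA).re_inner_nonneg_right h
  simpa [quadForm] using this

lemma quadForm_smul (t : ℝ) (h : Vec d) : quadForm A (t • h) = t ^ 2 * quadForm A h := by
  simp only [quadForm, map_smul, real_inner_smul_left, real_inner_smul_right]
  ring

lemma mul_inv_of_posDef (hA : A.PosDef) : A * A⁻¹ = 1 :=
  Matrix.mul_nonsing_inv _ hA.det_pos.ne'.isUnit

/-- The substitution `g = A^{1/2} h` turns the norm of `h` into the `A⁻¹`-norm of `g`. -/
lemma exists_sqrt_preimage (hA : A.PosDef) (g : Vec d) :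
    ∃ h : Vec d, Matrix.toEuclideanLin (CFC.sqrt A) h = g ∧ ‖h‖ ^ 2 = quadForm A⁻¹ g := by
  have hsq : CFC.sqrt A * CFC.sqrt A = A :=
    CFC.sqrt_mul_sqrt_self A (Matrix.nonneg_iff_posSemidef.2 hA.posSemidef)
  have hherm : (CFC.sqrt A).IsHermitian :=
    (Matrix.nonneg_iff_posSemidef.1 (CFC.sqrt_nonneg A)).isHermitian
  have hdet : IsUnit (CFC.sqrt A).det := by
    have : IsUnit ((CFC.sqrt A).det * (CFC.sqrt A).det) := by
      rw [← Matrix.det_mul, hsq]; exact hA.det_pos.ne'.isUnit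
    exact isUnit_of_mul_isUnit_left this
  have hinv : (CFC.sqrt A)⁻¹ * (CFC.sqrt A)⁻¹ = A⁻¹ := by rw [← Matrix.mul_inv_rev, hsq]
  refine ⟨Matrix.toEuclideanLin (CFC.sqrt A)⁻¹ g, ?_, ?_⟩
  · rw [← toEuclideanLin_mul, Matrix.mul_nonsing_inv _ hdet, toEuclideanLin_one]
  · rw [← real_inner_self_eq_norm_sq, inner_toEuclideanLin_comm hherm.inv, ← toEuclideanLin_mul,
      hinv, quadForm]

/-- Cocoercivity: the gap of a convex, `A`-smooth function over its tangent at `y` controls the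
change of its gradient in the `A⁻¹`-norm. -/
lemma ConvexMatrixSmooth.half_quadForm_inv_le {g : Vec d → ℝ} (hA : A.PosDef)
    (hg : ConvexMatrixSmooth A g) (x y : Vec d) :
    g y + inner ℝ (gradient g y) (x - y)
      + 1 / 2 * quadForm A⁻¹ (gradient g x - gradient g y) ≤ g x := by
  set a := gradient g x - gradient g y with ha
  set s := Matrix.toEuclideanLin A⁻¹ a with hs
  -- `x - s` minimizes the quadratic upper model at `x` minus the tangent at `y`
  have h1 := (hg.2 (x - s) y).1
  have h2 := (hg.2 (x - s) x).2
  have hq : quadForm A (x - s - x) = quadForm A⁻¹ a := by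
    rw [show x - s - x = -s by abel]
    simp only [quadForm, map_neg, inner_neg_neg]
    rw [hs, ← toEuclideanLin_mul, mul_inv_of_posDef hA, toEuclideanLin_one, real_inner_comm]
  have hi : inner ℝ (gradient g x) s - inner ℝ (gradient g y) s = quadForm A⁻¹ a := by
    rw [← inner_sub_left, ← ha, quadForm]
  rw [hq, show x - s - x = -s by abel, inner_neg_right] at h2
  rw [show x - s - y = (x - y) - s by abel, inner_sub_right] at h1
  linarith

end MatrixSmooth

/-! ### Deviations from the average -/

section Average

variable {n d : ℕ}

lemma average_add_smul (x e : Fin n → Vec d) (t : ℝ) :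
    average (fun i => x i + t • e i) = average x + t • average e := by
  simp only [average, Finset.sum_add_distrib, smul_add, ← Finset.smul_sum]
  rw [smul_comm]

lemma average_sub (x y : Fin n → Vec d) :
    average (fun i => x i - y i) = average x - average y := by
  simp only [average, Finset.sum_sub_distrib, smul_sub]

lemma sum_sub_average (hn : 0 < n) (x : Fin n → Vec d) : ∑ i, (x i - average x) = 0 := by
  have : (n : ℝ) ≠ 0 := by positivity
  rw [Finset.sum_sub_distrib, Finset.sum_const, Finset.card_univ, Fintype.card_fin,
    ← Nat.cast_smul_eq_nsmul ℝ, average, smul_smul, mul_one_div_cancel this, one_smul, sub_self]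

lemma sum_inner_sub_average (hn : 0 < n) (x y : Fin n → Vec d) :
    ∑ i, inner ℝ (x i - average x) (y i - average y) = ∑ i, inner ℝ (x i - average x) (y i) := by
  simp only [inner_sub_right _ _ (average y), Finset.sum_sub_distrib]
  rw [← sum_inner, sum_sub_average hn, inner_zero_left, sub_zero]

lemma sum_norm_sub_average_add_smul (hn : 0 < n) (x e : Fin n → Vec d) (t : ℝ) :
    ∑ i, ‖x i + t • e i - average (fun k => x k + t • e k)‖ ^ 2
      = ∑ i, ‖x i - average x‖ ^ 2 + 2 * t * ∑ i, inner ℝ (x i - average x) (e i)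
        + t ^ 2 * ∑ i, ‖e i - average e‖ ^ 2 := by
  rw [← sum_inner_sub_average hn, Finset.mul_sum, Finset.mul_sum, ← Finset.sum_add_distrib,
    ← Finset.sum_add_distrib]
  refine Finset.sum_congr rfl fun i _ => ?_
  rw [average_add_smul, show x i + t • e i - (average x + t • average e)
    = (x i - average x) + t • (e i - average e) by module, norm_add_sq_real, norm_smul, mul_pow,
    real_inner_smul_right, Real.norm_eq_abs, sq_abs]
  ring

end Average

namespace Data

variable {n d : ℕ} {m : Fin n → ℕ} (P : Data n d m)

/-! ### The minimizer of the regularized objective -/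

/-- The gradient in `x_i` of the smooth part of the objective. -/
noncomputable def smoothGradient (x : Fin n → Vec d) (i : Fin n) : Vec d :=
  (1 / (P.total : ℝ)) • ∑ j, gradient (P.loss i j) (x i)
    + (1 / (n : ℝ)) • (P.lam • (x i - average x))

lemma total_pos (hn : 0 < n) (hm : ∀ i, 0 < m i) : 0 < (P.total : ℝ) := by
  have : 0 < ∑ i, m i := Finset.sum_pos (fun i _ => hm i) ⟨⟨0, hn⟩, Finset.mem_univ _⟩
  exact_mod_cast this

lemma sum_loss_eq (hn : 0 < n) (x : Fin n → Vec d) :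
    1 / (P.total : ℝ) * ∑ i, ∑ j, P.loss i j (x i)
      = 1 / (n : ℝ) * ∑ i, P.localLoss i (x i) := by
  have : (n : ℝ) ≠ 0 := by positivity
  simp only [localLoss, ← Finset.mul_sum]
  field_simp

variable {P}

lemma strongConvexOn_objective (hn : 0 < n) {μ : ℝ} (hμ : 0 < μ) (hlam : 0 ≤ P.lam)
    (hstrong : ∀ i, StrongConvexOn Set.univ μ (P.localLoss i))
    (hreg : ∀ i, ProperClosedConvex (P.dom i) (P.reg i)) :
    StrongConvexOn {x : Fin n → Vec d | ∀ i, x i ∈ P.dom i} (μ / n) P.objective := by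
  have hn' : (0 : ℝ) < n := by positivity
  have hdom : Convex ℝ {x : Fin n → Vec d | ∀ i, x i ∈ P.dom i} :=
    fun x hx y hy a b ha hb hab i => (hreg i).2.1.1 (hx i) (hy i) ha hb hab
  refine ⟨hdom, fun x hx y hy a b ha hb hab => ?_⟩
  have h1 : ∑ i, P.localLoss i ((a • x + b • y) i) ≤ a * ∑ i, P.localLoss i (x i)
      + b * ∑ i, P.localLoss i (y i) - a * b * (μ / 2 * ∑ i, ‖x i - y i‖ ^ 2) := by
    simp only [Finset.mul_sum, ← Finset.sum_add_distrib, ← Finset.sum_sub_distrib]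
    refine Finset.sum_le_sum fun i _ => ?_
    simpa using (hstrong i).2 (Set.mem_univ (x i)) (Set.mem_univ (y i)) ha hb hab
  have h2 : ∑ i, ‖(a • x + b • y) i - average (a • x + b • y)‖ ^ 2
      ≤ a * ∑ i, ‖x i - average x‖ ^ 2 + b * ∑ i, ‖y i - average y‖ ^ 2 := by
    simp only [Finset.mul_sum, ← Finset.sum_add_distrib]
    refine Finset.sum_le_sum fun i _ => ?_
    have havg : average (a • x + b • y) = a • average x + b • average y := by
      simp only [average, Pi.add_apply, Pi.smul_apply, Finset.sum_add_distrib, smul_add,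
        ← Finset.smul_sum]
      rw [smul_comm a, smul_comm b]
    have hsq := (strongConvexOn_half_norm_sub_sq (0 : Vec d)).2 (Set.mem_univ (x i - average x))
      (Set.mem_univ (y i - average y)) ha hb hab
    have hdrop : 0 ≤ a * b * (1 / 2 * ‖x i - average x - (y i - average y)‖ ^ 2) := by positivity
    rw [havg, Pi.add_apply, Pi.smul_apply, Pi.smul_apply,
      show a • x i + b • y i - (a • average x + b • average y)
        = a • (x i - average x) + b • (y i - average y) by module]
    simp only [sub_zero, smul_eq_mul] at hsq
    linarith
  have h3 : ∑ i, P.reg i ((a • x + b • y) i)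
      ≤ a * ∑ i, P.reg i (x i) + b * ∑ i, P.reg i (y i) := by
    simp only [Finset.mul_sum, ← Finset.sum_add_distrib]
    exact Finset.sum_le_sum fun i _ => (hreg i).2.1.2 (hx i) (hy i) ha hb hab
  -- the norm on the product is the supremum norm, which the Euclidean one dominates
  have h4 : ‖x - y‖ ^ 2 ≤ ∑ i, ‖x i - y i‖ ^ 2 := by
    rw [← Real.sqrt_le_sqrt_iff (by positivity), Real.sqrt_sq (norm_nonneg _)]
    refine (pi_norm_le_iff_of_nonneg (Real.sqrt_nonneg _)).2 fun i => ?_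
    refine Real.le_sqrt_of_sq_le ?_
    exact Finset.single_le_sum (f := fun i => ‖x i - y i‖ ^ 2) (fun k _ => sq_nonneg _)
      (Finset.mem_univ i)
  have h5 : a * b * (μ / 2 * ‖x - y‖ ^ 2) ≤ a * b * (μ / 2 * ∑ i, ‖x i - y i‖ ^ 2) := by gcongr
  have h6 := mul_le_mul_of_nonneg_left (h1.trans (sub_le_sub_left h5 _))
    (one_div_pos.2 hn').le
  have h7 := mul_le_mul_of_nonneg_left (mul_le_mul_of_nonneg_left h2
    (by positivity : 0 ≤ 1 / (2 * (n : ℝ)))) hlam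
  have h8 : 1 / (n : ℝ) * (a * b * (μ / 2 * ‖x - y‖ ^ 2))
    = a * b * (μ / n / 2 * ‖x - y‖ ^ 2) := by field_simp
  simp only [objective, sum_loss_eq P hn, smul_eq_mul]
  linarith

lemma lscExtension_objective {M : ∀ i, Fin (m i) → Matrix (Fin d) (Fin d) ℝ}
    (hsmooth : ∀ i j, ConvexMatrixSmooth (M i j) (P.loss i j))
    (hreg : ∀ i, ProperClosedConvex (P.dom i) (P.reg i)) :
    LscExtension {x : Fin n → Vec d | ∀ i, x i ∈ P.dom i} P.objective := by
  have hc : ∀ i j, Continuous (P.loss i j) := fun i j => (hsmooth i j).1.continuous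
  have hφ : Continuous fun x : Fin n → Vec d =>
      1 / (P.total : ℝ) * ∑ i, ∑ j, P.loss i j (x i)
        + P.lam * (1 / (2 * (n : ℝ)) * ∑ i, ‖x i - average x‖ ^ 2) := by
    unfold average
    refine .add (continuous_const.mul ?_) (by fun_prop)
    exact continuous_finsetSum _ fun i _ => continuous_finsetSum _ fun j _ =>
      (hc i j).comp (continuous_apply i)
  convert (LscExtension.sum_pi fun i => (hreg i).lscExtension).const_mul_add one_pos hφ using 2
  rw [objective]
  ring

theorem exists_isSolution (hn : 0 < n) {μ : ℝ} (hμ : 0 < μ) (hlam : 0 ≤ P.lam)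
    {M : ∀ i, Fin (m i) → Matrix (Fin d) (Fin d) ℝ}
    (hsmooth : ∀ i j, ConvexMatrixSmooth (M i j) (P.loss i j))
    (hstrong : ∀ i, StrongConvexOn Set.univ μ (P.localLoss i))
    (hreg : ∀ i, ProperClosedConvex (P.dom i) (P.reg i)) :
    ∃ xs : Fin n → Vec d, P.IsSolution xs ∧ ∀ y, P.IsSolution y → y = xs := by
  have hμn : 0 < μ / n := by positivity
  have hcv := strongConvexOn_objective hn hμ hlam hstrong hreg
  choose x₀ hx₀ using fun i => (hreg i).1
  have hne : {x : Fin n → Vec d | ∀ i, x i ∈ P.dom i}.Nonempty := ⟨x₀, hx₀⟩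
  obtain ⟨xs, hxs, hmin⟩ := exists_min_of_strongConvexOn hμn hne hcv
    (lscExtension_objective hsmooth hreg)
  refine ⟨xs, ⟨hxs, hmin⟩, fun y hy => ?_⟩
  exact (hcv.strictConvexOn hμn).eq_of_isMinOn (fun z hz => hy.2 z hz) (fun z hz => hmin z hz)
    hy.1 hxs

/-- First-order optimality: `-∇_i` of the smooth part at a solution is a subgradient of `R_i`. -/
lemma IsSolution.variational (hn : 0 < n) {M : ∀ i, Fin (m i) → Matrix (Fin d) (Fin d) ℝ}
    (hsmooth : ∀ i j, ConvexMatrixSmooth (M i j) (P.loss i j))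
    (hreg : ∀ i, ProperClosedConvex (P.dom i) (P.reg i)) {xs : Fin n → Vec d}
    (hxs : P.IsSolution xs) (i : Fin n) {w : Vec d} (hw : w ∈ P.dom i) :
    0 ≤ inner ℝ (P.smoothGradient xs i) (w - xs i) + (P.reg i w - P.reg i (xs i)) := by
  classical
  -- first for a simultaneous change of all local models
  have key : ∀ y : Fin n → Vec d, (∀ k, y k ∈ P.dom k) →
      0 ≤ ∑ k, (inner ℝ (P.smoothGradient xs k) (y k - xs k)
        + (P.reg k (y k) - P.reg k (xs k))) := by
    intro y hy
    refine nonneg_of_quadratic_nonneg (b := 1 / (P.total : ℝ) *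
        ∑ k, ∑ j, 1 / 2 * quadForm (M k j) (y k - xs k)
      + P.lam * (1 / (2 * (n : ℝ)) *
        ∑ k, ‖y k - xs k - average fun l => y l - xs l‖ ^ 2)) fun t ht0 ht1 => ?_
    have hseg : ∀ k, xs k + t • (y k - xs k) = (1 - t) • xs k + t • y k := fun k => by module
    have h0 := hxs.2 (fun k => xs k + t • (y k - xs k)) fun k => by
      rw [hseg]
      exact (hreg k).2.1.1 (hxs.1 k) (hy k) (by linarith) ht0.le (by ring)
    have h1 : ∑ k, ∑ j, P.loss k j (xs k + t • (y k - xs k)) ≤ ∑ k, ∑ j, P.loss k j (xs k)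
        + t * ∑ k, ∑ j, inner ℝ (gradient (P.loss k j) (xs k)) (y k - xs k)
        + t ^ 2 * ∑ k, ∑ j, 1 / 2 * quadForm (M k j) (y k - xs k) := by
      simp only [Finset.mul_sum, ← Finset.sum_add_distrib]
      refine Finset.sum_le_sum fun k _ => Finset.sum_le_sum fun j _ => ?_
      have := ((hsmooth k j).2 (xs k + t • (y k - xs k)) (xs k)).2
      rw [add_sub_cancel_left, real_inner_smul_right, quadForm_smul] at this
      linarith
    have h2 : ∑ k, P.reg k (xs k + t • (y k - xs k))
        ≤ ∑ k, P.reg k (xs k) + t * ∑ k, (P.reg k (y k) - P.reg k (xs k)) := by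
      simp only [Finset.mul_sum, ← Finset.sum_add_distrib]
      refine Finset.sum_le_sum fun k _ => ?_
      have := (hreg k).2.1.2 (hxs.1 k) (hy k) (sub_nonneg.2 ht1.le) ht0.le (by ring)
      rw [hseg]
      simp only [smul_eq_mul] at this
      linarith
    have h3 := sum_norm_sub_average_add_smul hn xs (fun k => y k - xs k) t
    have h4 : ∑ k, inner ℝ (P.smoothGradient xs k) (y k - xs k)
        = 1 / (P.total : ℝ) * ∑ k, ∑ j, inner ℝ (gradient (P.loss k j) (xs k)) (y k - xs k)
          + P.lam * (1 / (n : ℝ)) * ∑ k, inner ℝ (xs k - average xs) (y k - xs k) := by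
      simp only [smoothGradient, inner_add_left, real_inner_smul_left, sum_inner,
        Finset.sum_add_distrib, Finset.mul_sum]
      congr 1
      exact Finset.sum_congr rfl fun k _ => by ring
    have h5 := mul_le_mul_of_nonneg_left h1 (by positivity : 0 ≤ 1 / (P.total : ℝ))
    have h6 : 1 / (2 * (n : ℝ)) = 1 / 2 * (1 / n) := by field_simp
    rw [objective, objective, h3, h6] at h0
    rw [Finset.sum_add_distrib, h4, h6]
    linarith
  have hy := key (Function.update xs i w) fun k => by
    rcases eq_or_ne k i with rfl | hk
    · simpa using hw
    · simpa [hk] using hxs.1 k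
  rw [Finset.sum_eq_single i (fun k _ hk => by simp [hk]) (by simp)] at hy
  simpa using hy

/-- The strong convexity of a local objective, in first-order form. -/
lemma localLoss_add_inner_add_le {M : ∀ i, Fin (m i) → Matrix (Fin d) (Fin d) ℝ}
    (hsmooth : ∀ i j, ConvexMatrixSmooth (M i j) (P.loss i j)) {μ : ℝ} {i : Fin n}
    (hstrong : StrongConvexOn Set.univ μ (P.localLoss i)) (x y : Vec d) :
    P.localLoss i x + (n : ℝ) / P.total * ∑ j, inner ℝ (gradient (P.loss i j) x) (y - x)
      + μ / 2 * ‖y - x‖ ^ 2 ≤ P.localLoss i y := by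
  suffices H : 0 ≤ P.localLoss i y - P.localLoss i x - μ / 2 * ‖y - x‖ ^ 2
      - (n : ℝ) / P.total * ∑ j, inner ℝ (gradient (P.loss i j) x) (y - x) by linarith
  refine nonneg_of_quadratic_nonneg (b := μ / 2 * ‖y - x‖ ^ 2) fun t ht0 ht1 => ?_
  have h1 := hstrong.2 (Set.mem_univ x) (Set.mem_univ y) (sub_nonneg.2 ht1.le) ht0.le (by ring)
  have h2 : P.localLoss i x
      + t * ((n : ℝ) / P.total * ∑ j, inner ℝ (gradient (P.loss i j) x) (y - x))
      ≤ P.localLoss i ((1 - t) • x + t • y) := by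
    rw [localLoss, localLoss, mul_left_comm, ← mul_add, Finset.mul_sum,
      ← Finset.sum_add_distrib]
    refine mul_le_mul_of_nonneg_left (Finset.sum_le_sum fun j _ => ?_) (by positivity)
    have := ((hsmooth i j).2 ((1 - t) • x + t • y) x).1
    rwa [show (1 - t) • x + t • y - x = t • (y - x) by module, real_inner_smul_right] at this
  rw [norm_sub_rev x y] at h1
  simp only [smul_eq_mul] at h1
  linarith

/-- Strong monotonicity of `∇f_i`, with one of the two Bregman divergences spent on cocoercivity
and the other on strong convexity. -/
lemma le_inner_sum_gradient_sub {M : ∀ i, Fin (m i) → Matrix (Fin d) (Fin d) ℝ}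
    (hn : 0 < n) (hM : ∀ i j, (M i j).PosDef)
    (hsmooth : ∀ i j, ConvexMatrixSmooth (M i j) (P.loss i j)) {μ : ℝ} {i : Fin n}
    (hstrong : StrongConvexOn Set.univ μ (P.localLoss i)) (x y : Vec d) :
    1 / (2 * (P.total : ℝ)) *
        ∑ j, quadForm (M i j)⁻¹ (gradient (P.loss i j) x - gradient (P.loss i j) y)
      + μ / (2 * n) * ‖x - y‖ ^ 2
    ≤ inner ℝ (x - y)
        ((1 / (P.total : ℝ)) • ∑ j, (gradient (P.loss i j) x - gradient (P.loss i j) y)) := by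
  have hn' : (0 : ℝ) < n := by positivity
  have h1 := localLoss_add_inner_add_le hsmooth hstrong x y
  have h2 := Finset.sum_le_sum fun j (_ : j ∈ Finset.univ) =>
    (hsmooth i j).half_quadForm_inv_le (hM i j) x y
  simp only [Finset.sum_add_distrib, ← Finset.mul_sum] at h2
  have h3 := mul_le_mul_of_nonneg_left h1 (one_div_pos.2 hn').le
  have h4 := mul_le_mul_of_nonneg_left h2 (by positivity : 0 ≤ 1 / (P.total : ℝ))
  have h5 : ∀ s : ℝ, 1 / (n : ℝ) * ((n : ℝ) / P.total * s) = 1 / (P.total : ℝ) * s := by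
    intro s; field_simp
  have h6 : 1 / (2 * (P.total : ℝ)) = 1 / 2 * (1 / P.total) := by field_simp
  have h7 : μ / (2 * n) * ‖x - y‖ ^ 2 = 1 / n * (μ / 2 * ‖y - x‖ ^ 2) := by
    rw [norm_sub_rev]; field_simp
  have h8 : ∀ g : Vec d, inner ℝ g (y - x) = -inner ℝ g (x - y) := by
    intro g; rw [← neg_sub x y, inner_neg_right]
  rw [mul_add, mul_add, h5, localLoss, localLoss, h5, h5] at h3
  simp only [h8, Finset.sum_neg_distrib] at h3
  rw [h6, h7, real_inner_comm, real_inner_smul_left, sum_inner]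
  simp only [inner_sub_left _ _ (x - y), Finset.sum_sub_distrib]
  linarith

end Data

/-! ### Finite probability -/

lemma sum_toReal_pmf {β : Type*} [Fintype β] (q : PMF β) : ∑ b, (q b).toReal = 1 := by
  rw [← ENNReal.toReal_sum fun b _ => q.apply_ne_top b,
    ← tsum_fintype (L := .unconditional _) (fun b => q b), q.tsum_coe, ENNReal.toReal_one]

/-- Marginalization: under a product of finite probability weights, the mean of a function of one
coordinate is its mean under the weights of that coordinate. -/
lemma sum_prod_smul_apply {ι : Type*} [Fintype ι] [DecidableEq ι] {β : ι → Type*}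
    [∀ i, Fintype (β i)] {V : Type*} [AddCommGroup V] [Module ℝ V] (q : ∀ i, β i → ℝ)
    (hq : ∀ i, ∑ b, q i b = 1) (i : ι) (f : β i → V) :
    ∑ s : ∀ k, β k, (∏ k, q k (s k)) • f (s i) = ∑ b, q i b • f b := by
  rw [← (Equiv.piSplitAt i β).symm.sum_comp, Fintype.sum_prod_type]
  refine Finset.sum_congr rfl fun b _ => ?_
  have h : ∀ r : ∀ k : {k // k ≠ i}, β k,
      (∏ k, q k ((Equiv.piSplitAt i β).symm (b, r) k)) • f ((Equiv.piSplitAt i β).symm (b, r) i)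
        = (∏ k : {k // k ≠ i}, q k (r k)) • q i b • f b := by
    intro r
    rw [Fintype.prod_eq_mul_prod_subtype_ne _ i, mul_comm, mul_smul]
    congr 1
    · refine Finset.prod_congr rfl fun k _ => ?_
      simp [Equiv.piSplitAt, k.2]
    · simp [Equiv.piSplitAt]
  simp only [h]
  rw [← Finset.sum_smul, ← Fintype.prod_sum]
  simp [hq]

/-- A random vector with finitely many values is at most as far from its mean as from `0`. -/
lemma sum_mul_norm_sub_mean_sq_le {Ω V : Type*} [Fintype Ω] [NormedAddCommGroup V]
    [InnerProductSpace ℝ V] {π : Ω → ℝ} (hπ1 : ∑ w, π w = 1) {Q : Ω → V}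
    {c : V} (hc : ∑ w, π w • Q w = c) :
    ∑ w, π w * ‖Q w - c‖ ^ 2 ≤ ∑ w, π w * ‖Q w‖ ^ 2 := by
  have h : ∑ w, π w * ‖Q w - c‖ ^ 2
      = ∑ w, π w * ‖Q w‖ ^ 2 - 2 * inner ℝ (∑ w, π w • Q w) c + (∑ w, π w) * ‖c‖ ^ 2 := by
    rw [sum_inner, Finset.mul_sum, Finset.sum_mul, ← Finset.sum_sub_distrib,
      ← Finset.sum_add_distrib]
    refine Finset.sum_congr rfl fun w _ => ?_
    rw [norm_sub_sq_real, real_inner_smul_left]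
    ring
  rw [h, hc, hπ1, real_inner_self_eq_norm_sq]
  nlinarith [sq_nonneg ‖c‖]

/-- One gradient step with the estimate `g - q + E q` of `E g`, in mean square. The noise of
the control variate `q` is measured around its mean, so each part counts twice, not four times. -/
lemma sum_mul_norm_step_sq_le {Ω V : Type*} [Fintype Ω] [NormedAddCommGroup V]
    [InnerProductSpace ℝ V] {π : Ω → ℝ} (hπ : ∀ w, 0 ≤ π w) (hπ1 : ∑ w, π w = 1)
    {g q : Ω → V} {c c' : V} (hq : ∑ w, π w • q w = c) (hp : ∑ w, π w • g w = c') (y : V)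
    (α : ℝ) :
    ∑ w, π w * ‖y - α • (g w - q w + c)‖ ^ 2
      ≤ ‖y‖ ^ 2 - 2 * α * inner ℝ y c'
        + 2 * α ^ 2 * (∑ w, π w * ‖g w‖ ^ 2 + ∑ w, π w * ‖q w‖ ^ 2) := by
  have hmean : ∑ w, π w • (g w - q w + c) = c' := by
    simp only [smul_add, smul_sub, Finset.sum_add_distrib, Finset.sum_sub_distrib]
    rw [hq, hp, ← Finset.sum_smul, hπ1, one_smul, sub_add_cancel]
  have hexp : ∑ w, π w * ‖y - α • (g w - q w + c)‖ ^ 2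
      = ‖y‖ ^ 2 - 2 * α * inner ℝ y c' + α ^ 2 * ∑ w, π w * ‖g w - q w + c‖ ^ 2 := by
    have h1 : ‖y‖ ^ 2 = ∑ w, π w * ‖y‖ ^ 2 := by rw [← Finset.sum_mul, hπ1, one_mul]
    rw [h1, ← hmean, inner_sum, Finset.mul_sum, Finset.mul_sum, ← Finset.sum_sub_distrib,
      ← Finset.sum_add_distrib]
    refine Finset.sum_congr rfl fun w _ => ?_
    rw [norm_sub_sq_real, real_inner_smul_right, real_inner_smul_right, norm_smul, mul_pow,
      Real.norm_eq_abs, sq_abs]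
    ring
  have hsplit : ∑ w, π w * ‖g w - q w + c‖ ^ 2
      ≤ 2 * ∑ w, π w * ‖g w‖ ^ 2 + 2 * ∑ w, π w * ‖q w - c‖ ^ 2 := by
    rw [Finset.mul_sum, Finset.mul_sum, ← Finset.sum_add_distrib]
    refine Finset.sum_le_sum fun w _ => ?_
    have h2 : ‖g w - q w + c‖ ^ 2 ≤ 2 * ‖g w‖ ^ 2 + 2 * ‖q w - c‖ ^ 2 := by
      have := parallelogram_law_with_norm ℝ (g w) (q w - c)
      rw [show g w - q w + c = g w - (q w - c) by abel]
      nlinarith [mul_self_nonneg ‖g w + (q w - c)‖]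
    nlinarith [hπ w]
  have hvar := sum_mul_norm_sub_mean_sq_le hπ1 hq
  rw [hexp]
  nlinarith [sq_nonneg α]

namespace Data

variable {n d : ℕ} {m : Fin n → ℕ} {P : Data n d m}

/-! ### The random choices of one iteration -/

lemma drawProb_nonneg (hp : 0 < P.pAgg ∧ P.pAgg < 1) (hrho : ∀ i, 0 < P.rho i ∧ P.rho i ≤ 1)
    (w : Draw n m) : 0 ≤ P.drawProb w := by
  have h1 : 0 ≤ if w.1 then P.pAgg else 1 - P.pAgg := by split_ifs <;> linarith
  have h2 : 0 ≤ ∏ i, (if w.2.2.2 i then P.rho i else 1 - P.rho i) :=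
    Finset.prod_nonneg fun i _ => by split_ifs <;> linarith [hrho i]
  unfold drawProb
  positivity

/-- Only the coins, the active set and the sample of client `i` matter for a function of these. -/
lemma sum_drawProb_smul {V : Type*} [AddCommGroup V] [Module ℝ V] (i : Fin n)
    (f : Bool → Finset (Fin n) → Finset (Fin (m i)) → Bool → V) :
    ∑ w : Draw n m, P.drawProb w • f w.1 w.2.1 (w.2.2.1 i) (w.2.2.2 i)
      = ∑ ξ : Bool, (if ξ then P.pAgg else 1 - P.pAgg) • ∑ C, (P.clients C).toReal •
          ∑ S, (P.batch i S).toReal • ∑ b : Bool, (if b then P.rho i else 1 - P.rho i) •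
            f ξ C S b := by
  rw [Fintype.sum_prod_type]
  refine Finset.sum_congr rfl fun ξ _ => ?_
  rw [Fintype.sum_prod_type, Finset.smul_sum]
  refine Finset.sum_congr rfl fun C _ => ?_
  rw [Fintype.sum_prod_type,
    ← sum_prod_smul_apply (fun k S => (P.batch k S).toReal) (fun k => sum_toReal_pmf _) i,
    Finset.smul_sum, Finset.smul_sum]
  refine Finset.sum_congr rfl fun S _ => ?_
  rw [← sum_prod_smul_apply (β := fun _ => Bool)
    (fun k b => if b then P.rho k else 1 - P.rho k) (fun k => by simp) i]
  simp only [Finset.smul_sum, smul_smul]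
  refine Finset.sum_congr rfl fun b _ => ?_
  simp only [drawProb, mul_assoc]

lemma sum_clients_mem (i : Fin n) {V : Type*} [AddCommGroup V] [Module ℝ V] (a b : V) :
    ∑ C, (P.clients C).toReal • (if i ∈ C then a else b)
      = P.pClient i • a + (1 - P.pClient i) • b := by
  rw [← sum_toReal_pmf P.clients, pClient, ← Finset.sum_sub_distrib, Finset.sum_smul,
    Finset.sum_smul, ← Finset.sum_add_distrib]
  refine Finset.sum_congr rfl fun C _ => ?_
  split_ifs <;> simp

/-- The mean of a quantity that takes separate values on aggregation steps, on local steps with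
client `i` active, and on local steps with client `i` idle. -/
lemma sum_drawProb_cases {V : Type*} [AddCommGroup V] [Module ℝ V] (i : Fin n) (a c : V)
    (f : Finset (Fin (m i)) → Bool → V) :
    ∑ w : Draw n m, P.drawProb w • (if w.1 then a else if i ∈ w.2.1 then
        f (w.2.2.1 i) (w.2.2.2 i) else c)
      = P.pAgg • a + (1 - P.pAgg) • (P.pClient i • (∑ S, (P.batch i S).toReal •
          (P.rho i • f S true + (1 - P.rho i) • f S false)) + (1 - P.pClient i) • c) := by
  rw [sum_drawProb_smul i fun ξ C S b => if ξ then a else if i ∈ C then f S b else c]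
  have hS : ∀ v : V, ∑ S, (P.batch i S).toReal • v = v := fun v => by
    rw [← Finset.sum_smul, sum_toReal_pmf, one_smul]
  have hb : ∀ v : V, P.rho i • v + (1 - P.rho i) • v = v := fun v => by module
  have hC : ∀ v : V, ∑ C, (P.clients C).toReal • v = v := fun v => by
    rw [← Finset.sum_smul, sum_toReal_pmf, one_smul]
  simp only [Fintype.sum_bool, if_true, Bool.false_eq_true, if_false, hb, hS, hC]
  rw [← sum_clients_mem]
  congr 2
  refine Finset.sum_congr rfl fun C _ => ?_
  split_ifs
  · rfl
  · simp only [hb, hS]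

lemma sum_drawProb (hn : 0 < n) : ∑ w : Draw n m, P.drawProb w = 1 := by
  have := sum_drawProb_cases (P := P) ⟨0, hn⟩ (1 : ℝ) 1 fun _ _ => 1
  simp only [ite_self, smul_eq_mul, mul_one, ← Finset.sum_mul, sum_toReal_pmf] at this
  rw [this]
  ring

lemma sum_batch_smul (i : Fin n) {V : Type*} [AddCommGroup V] [Module ℝ V]
    (c : Fin (m i) → V) :
    ∑ S, (P.batch i S).toReal • ∑ j ∈ S, c j = ∑ j, P.pIndex i j • c j := by
  simp only [pIndex, Finset.sum_smul]
  rw [Finset.sum_comm]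
  refine Finset.sum_congr rfl fun S _ => ?_
  simp [ite_smul, Finset.smul_sum]

/-! ### The sampled part of the estimator -/

variable (P) in
/-- The unbiased sample of `(1/N) ∑_j a_j + (1/n) u` that client `i` draws: a multiple of `u` in an
aggregation step, an importance-weighted sum of the sampled `a_j` in a local step. -/
noncomputable def sampled (i : Fin n) (a : Fin (m i) → Vec d) (u : Vec d) (w : Draw n m) : Vec d :=
  if w.1 then (1 / ((n : ℝ) * P.pAgg)) • u
  else if i ∈ w.2.1 then (1 / ((P.total : ℝ) * (1 - P.pAgg) * P.pClient i)) •
    ∑ j ∈ w.2.2.1 i, (P.pIndex i j)⁻¹ • a j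
  else 0

lemma sum_drawProb_smul_sampled (hp : 0 < P.pAgg ∧ P.pAgg < 1) (hclient : ∀ i, 0 < P.pClient i)
    (hindex : ∀ i j, 0 < P.pIndex i j) (i : Fin n) (a : Fin (m i) → Vec d) (u : Vec d) :
    ∑ w : Draw n m, P.drawProb w • P.sampled i a u w
      = (1 / (P.total : ℝ)) • ∑ j, a j + (1 / (n : ℝ)) • u := by
  have hp0 := hp.1.ne'
  have hp1 : 1 - P.pAgg ≠ 0 := (sub_pos.2 hp.2).ne'
  have hc := (hclient i).ne'
  unfold sampled
  rw [sum_drawProb_cases i ((1 / ((n : ℝ) * P.pAgg)) • u) 0 fun S _ =>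
    (1 / ((P.total : ℝ) * (1 - P.pAgg) * P.pClient i)) • ∑ j ∈ S, (P.pIndex i j)⁻¹ • a j]
  have hb : ∀ v : Vec d, P.rho i • v + (1 - P.rho i) • v = v := fun v => by module
  have hS : ∑ S, (P.batch i S).toReal • ((1 / ((P.total : ℝ) * (1 - P.pAgg) * P.pClient i)) •
      ∑ j ∈ S, (P.pIndex i j)⁻¹ • a j)
      = (1 / ((P.total : ℝ) * (1 - P.pAgg) * P.pClient i)) • ∑ j, a j := by
    simp only [smul_comm _ (1 / ((P.total : ℝ) * (1 - P.pAgg) * P.pClient i))]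
    rw [← Finset.smul_sum, sum_batch_smul]
    simp only [smul_smul, mul_inv_cancel₀ (hindex i _).ne', one_smul]
  simp only [hb, hS]
  rw [smul_zero, add_zero, smul_smul, smul_smul, smul_smul, add_comm]
  congr 2 <;> field_simp

lemma ESO.v_nonneg {M : ∀ i, Fin (m i) → Matrix (Fin d) (Fin d) ℝ} {v : ∀ i, Fin (m i) → ℝ}
    (hESO : P.ESO M v) (hd : 0 < d) (hindex : ∀ i j, 0 < P.pIndex i j) (i : Fin n)
    (j : Fin (m i)) : 0 ≤ v i j := by
  have h := hESO i (Pi.single j (EuclideanSpace.single ⟨0, hd⟩ 1))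
  rw [Finset.sum_eq_single j (fun k _ hk => by simp [hk]) (by simp)] at h
  have h0 := (Finset.sum_nonneg fun S _ => by positivity).trans h
  simp only [Pi.single_eq_same, PiLp.norm_single, norm_one, one_pow, mul_one] at h0
  exact nonneg_of_mul_nonneg_right h0 (hindex i j)

lemma sum_drawProb_mul_norm_sampled_sq_le (hn : 0 < n) (hm : ∀ i, 0 < m i)
    (hp : 0 < P.pAgg ∧ P.pAgg < 1)
    (hclient : ∀ i, 0 < P.pClient i) (hindex : ∀ i j, 0 < P.pIndex i j)
    {M : ∀ i, Fin (m i) → Matrix (Fin d) (Fin d) ℝ} (hM : ∀ i j, (M i j).PosDef)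
    {v : ∀ i, Fin (m i) → ℝ} (hESO : P.ESO M v) (i : Fin n) (a : Fin (m i) → Vec d) (u : Vec d) :
    ∑ w : Draw n m, P.drawProb w * ‖P.sampled i a u w‖ ^ 2
      ≤ 1 / ((P.total : ℝ) ^ 2 * (1 - P.pAgg) * P.pClient i) *
          ∑ j, v i j / P.pIndex i j * quadForm (M i j)⁻¹ (a j)
        + 1 / ((n : ℝ) ^ 2 * P.pAgg) * ‖u‖ ^ 2 := by
  have hN := P.total_pos hn hm
  have hn' : (0 : ℝ) < n := by positivity
  have hp0 := hp.1
  have hp1 : 0 < 1 - P.pAgg := sub_pos.2 hp.2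
  have hc := hclient i
  have hsq : ∀ w : Draw n m, ‖P.sampled i a u w‖ ^ 2
      = if w.1 then (1 / ((n : ℝ) * P.pAgg)) ^ 2 * ‖u‖ ^ 2
        else if i ∈ w.2.1 then (1 / ((P.total : ℝ) * (1 - P.pAgg) * P.pClient i)) ^ 2 *
          ‖∑ j ∈ w.2.2.1 i, (P.pIndex i j)⁻¹ • a j‖ ^ 2 else 0 := by
    intro w
    unfold sampled
    split_ifs
    · rw [norm_smul, mul_pow, Real.norm_eq_abs, sq_abs]
    · rw [norm_smul, mul_pow, Real.norm_eq_abs, sq_abs]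
    · simp
  have hE := sum_drawProb_cases (P := P) i ((1 / ((n : ℝ) * P.pAgg)) ^ 2 * ‖u‖ ^ 2) 0 fun S _ =>
    (1 / ((P.total : ℝ) * (1 - P.pAgg) * P.pClient i)) ^ 2 *
      ‖∑ j ∈ S, (P.pIndex i j)⁻¹ • a j‖ ^ 2
  have hb : ∀ s : ℝ, P.rho i * s + (1 - P.rho i) * s = s := fun s => by ring
  simp only [smul_eq_mul, hb, mul_zero, add_zero] at hE
  simp only [hsq, hE]
  choose h hh hnorm using fun j => exists_sqrt_preimage (hM i j) ((P.pIndex i j)⁻¹ • a j)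
  have heso := hESO i h
  simp only [hh, hnorm, quadForm_smul] at heso
  have hs : ∑ j, P.pIndex i j * v i j * ((P.pIndex i j)⁻¹ ^ 2 * quadForm (M i j)⁻¹ (a j))
      = ∑ j, v i j / P.pIndex i j * quadForm (M i j)⁻¹ (a j) :=
    Finset.sum_congr rfl fun j _ => by
      have := (hindex i j).ne'
      field_simp
  rw [hs] at heso
  have hS : ∑ S, (P.batch i S).toReal * ((1 / ((P.total : ℝ) * (1 - P.pAgg) * P.pClient i)) ^ 2 *
      ‖∑ j ∈ S, (P.pIndex i j)⁻¹ • a j‖ ^ 2)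
      = (1 / ((P.total : ℝ) * (1 - P.pAgg) * P.pClient i)) ^ 2 *
        ∑ S, (P.batch i S).toReal * ‖∑ j ∈ S, (P.pIndex i j)⁻¹ • a j‖ ^ 2 := by
    rw [Finset.mul_sum]
    exact Finset.sum_congr rfl fun S _ => by ring
  have h1 : P.pAgg * ((1 / ((n : ℝ) * P.pAgg)) ^ 2 * ‖u‖ ^ 2)
      = 1 / ((n : ℝ) ^ 2 * P.pAgg) * ‖u‖ ^ 2 := by field_simp
  have h2 : ∀ s : ℝ, (1 - P.pAgg) * (P.pClient i *
      ((1 / ((P.total : ℝ) * (1 - P.pAgg) * P.pClient i)) ^ 2 * s))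
      = 1 / ((P.total : ℝ) ^ 2 * (1 - P.pAgg) * P.pClient i) * s := by
    intro s; field_simp
  rw [hS, h1, h2, add_comm]
  gcongr

/-- The error of the estimator against the gradient at `xs`, as a sample of the gradient change
corrected by a centred sample of the control variate errors. -/
lemma estimator_sub_smoothGradient (hp : 0 < P.pAgg) (s : State n d m) (xs : Fin n → Vec d)
    (w : Draw n m) (i : Fin n) :
    P.estimator s w i - P.smoothGradient xs i
      = P.sampled i (fun j => gradient (P.loss i j) (s.x i) - gradient (P.loss i j) (xs i))
          (P.lam • (s.x i - average s.x) - P.lam • (xs i - average xs)) w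
        - P.sampled i (fun j => s.J i j - gradient (P.loss i j) (xs i))
          (s.Psi i - P.lam • (xs i - average xs)) w
        + ((1 / (P.total : ℝ)) • ∑ j, (s.J i j - gradient (P.loss i j) (xs i))
          + (1 / (n : ℝ)) • (s.Psi i - P.lam • (xs i - average xs))) := by
  have h1 : P.lam / ((n : ℝ) * P.pAgg) = 1 / (n * P.pAgg) * P.lam := by ring
  have h2 : (P.pAgg⁻¹ - 1) / (n : ℝ) = 1 / (n * P.pAgg) - 1 / n := by field_simp
  unfold estimator sampled smoothGradient
  split_ifs
  · rw [h1, h2]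
    simp only [Finset.sum_sub_distrib]
    module
  · simp only [Finset.sum_sub_distrib, smul_sub]
    module
  · simp only [Finset.sum_sub_distrib]
    module

/-! ### The stepsize -/

section Stepsize

variable {μ : ℝ} {v : ∀ i, Fin (m i) → ℝ}

lemma stepsize_denom_pos (hn : 0 < n) (hm : ∀ i, 0 < m i) (hrho : ∀ i, 0 < P.rho i ∧ P.rho i ≤ 1)
    (hindex : ∀ i j, 0 < P.pIndex i j) (hμ : 0 < μ) (hv : ∀ i j, 0 ≤ v i j) (i : Fin n)
    (j : Fin (m i)) :
    0 < 4 * (v i j / P.pIndex i j) + (P.total : ℝ) * (μ / (n : ℝ)) * (P.rho i)⁻¹ := by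
  have hN := P.total_pos hn hm
  have hn' : (0 : ℝ) < n := by positivity
  have := hv i j
  have := hindex i j
  have := (hrho i).1
  positivity

lemma stepsize_numer_pos (hn : 0 < n) (hm : ∀ i, 0 < m i) (hp : 0 < P.pAgg ∧ P.pAgg < 1)
    (hclient : ∀ i, 0 < P.pClient i) (i : Fin n) :
    0 < (P.total : ℝ) * (1 - P.pAgg) * P.pClient i :=
  mul_pos (mul_pos (P.total_pos hn hm) (sub_pos.2 hp.2)) (hclient i)

lemma stepsize_mul_le (hn : 0 < n) (hm : ∀ i, 0 < m i)
    (hrho : ∀ i, 0 < P.rho i ∧ P.rho i ≤ 1)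
    (hindex : ∀ i j, 0 < P.pIndex i j) (hμ : 0 < μ) (hv : ∀ i j, 0 ≤ v i j) (i : Fin n)
    (j : Fin (m i)) :
    P.stepsize μ v * (4 * (v i j / P.pIndex i j) + (P.total : ℝ) * (μ / (n : ℝ)) * (P.rho i)⁻¹)
      ≤ (P.total : ℝ) * (1 - P.pAgg) * P.pClient i := by
  rw [← le_div_iff₀ (stepsize_denom_pos hn hm hrho hindex hμ hv i j)]
  exact (min_le_left _ _).trans
    (ciInf_le (Set.finite_range _).bddBelow (⟨i, j⟩ : (i : Fin n) × Fin (m i)))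

lemma stepsize_mul_le_pAgg_mul (hlam : 0 ≤ P.lam) (hμ : 0 < μ) :
    P.stepsize μ v * (4 * P.lam + μ) ≤ P.pAgg * n := by
  rw [← le_div_iff₀ (by positivity)]
  exact min_le_right _ _

/-- The minimum defining the stepsize is attained. -/
lemma stepsize_eq_or (hn : 0 < n) (hm : ∀ i, 0 < m i) :
    (∃ i j, P.stepsize μ v = ((P.total : ℝ) * (1 - P.pAgg) * P.pClient i) /
        (4 * (v i j / P.pIndex i j) + (P.total : ℝ) * (μ / (n : ℝ)) * (P.rho i)⁻¹)) ∨
      P.stepsize μ v = P.pAgg * (n : ℝ) / (4 * P.lam + μ) := by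
  have : Nonempty ((i : Fin n) × Fin (m i)) := ⟨⟨⟨0, hn⟩, ⟨0, hm _⟩⟩⟩
  obtain ⟨a, ha⟩ := exists_eq_ciInf_of_finite (f := fun a : (i : Fin n) × Fin (m i) =>
      ((P.total : ℝ) * (1 - P.pAgg) * P.pClient a.1) /
        (4 * (v a.1 a.2 / P.pIndex a.1 a.2)
          + (P.total : ℝ) * (μ / (n : ℝ)) * (P.rho a.1)⁻¹))
  rcases min_choice (⨅ a : (i : Fin n) × Fin (m i),
      ((P.total : ℝ) * (1 - P.pAgg) * P.pClient a.1) /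
        (4 * (v a.1 a.2 / P.pIndex a.1 a.2)
          + (P.total : ℝ) * (μ / (n : ℝ)) * (P.rho a.1)⁻¹))
    (P.pAgg * (n : ℝ) / (4 * P.lam + μ)) with h | h
  · exact Or.inl ⟨a.1, a.2, h.trans ha.symm⟩
  · exact Or.inr h

lemma stepsize_pos (hn : 0 < n) (hm : ∀ i, 0 < m i) (hp : 0 < P.pAgg ∧ P.pAgg < 1)
    (hrho : ∀ i, 0 < P.rho i ∧ P.rho i ≤ 1) (hclient : ∀ i, 0 < P.pClient i)
    (hindex : ∀ i j, 0 < P.pIndex i j) (hlam : 0 ≤ P.lam) (hμ : 0 < μ)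
    (hv : ∀ i j, 0 ≤ v i j) : 0 < P.stepsize μ v := by
  rcases stepsize_eq_or (P := P) (μ := μ) (v := v) hn hm with ⟨i, j, h⟩ | h
  · rw [h]
    exact div_pos (stepsize_numer_pos hn hm hp hclient i)
      (stepsize_denom_pos hn hm hrho hindex hμ hv i j)
  · have := hp.1
    rw [h]
    positivity

/-- The complexity constant is at least the reciprocal of the contraction gap `α μ / n`. -/
lemma one_le_complexity_mul (hn : 0 < n) (hm : ∀ i, 0 < m i) (hp : 0 < P.pAgg ∧ P.pAgg < 1)
    (hrho : ∀ i, 0 < P.rho i ∧ P.rho i ≤ 1) (hclient : ∀ i, 0 < P.pClient i)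
    (hindex : ∀ i j, 0 < P.pIndex i j) (hlam : 0 ≤ P.lam) (hμ : 0 < μ)
    (hv : ∀ i j, 0 ≤ v i j) : 1 ≤ P.complexity μ v * (P.stepsize μ v * μ / n) := by
  have hn' : (0 : ℝ) < n := by positivity
  have hN := P.total_pos hn hm
  have hα := stepsize_pos hn hm hp hrho hclient hindex hlam hμ hv
  rw [← div_le_iff₀ (by positivity)]
  rcases stepsize_eq_or (P := P) (μ := μ) (v := v) hn hm with ⟨i, j, h⟩ | h
  · refine le_trans (le_of_eq ?_) ((le_ciSup (Set.finite_range _).bddAbove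
      (⟨i, j⟩ : (i : Fin n) × Fin (m i))).trans (le_max_left _ _))
    have h1 := (hclient i).ne'
    have h2 := (hindex i j).ne'
    have h3 := (hrho i).1.ne'
    have h4 := (sub_pos.2 hp.2).ne'
    have h5 := (stepsize_denom_pos hn hm hrho hindex hμ hv i j).ne'
    rw [h]
    generalize hD : 4 * (v i j / P.pIndex i j) + (P.total : ℝ) * (μ / (n : ℝ)) * (P.rho i)⁻¹ = D
      at h5
    have h6 : 4 * v i j * ((n : ℝ) / ((P.total : ℝ) * P.pIndex i j)) + μ * (P.rho i)⁻¹
        = n / P.total * D := by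
      rw [← hD]; field_simp
    simp only [h6]
    field_simp
  · refine le_trans (le_of_eq ?_) (le_max_right _ _)
    have h1 := hp.1.ne'
    have h2 : 4 * P.lam + μ ≠ 0 := by positivity
    rw [h]
    field_simp

end Stepsize

/-! ### Descent of the Lyapunov function in one iteration -/

lemma sum_drawProb_mul_norm_step_x_sub_sq_le (hn : 0 < n) (hm : ∀ i, 0 < m i)
    (hp : 0 < P.pAgg ∧ P.pAgg < 1)
    (hrho : ∀ i, 0 < P.rho i ∧ P.rho i ≤ 1) (hclient : ∀ i, 0 < P.pClient i)
    (hindex : ∀ i j, 0 < P.pIndex i j)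
    {M : ∀ i, Fin (m i) → Matrix (Fin d) (Fin d) ℝ} (hM : ∀ i j, (M i j).PosDef)
    (hsmooth : ∀ i j, ConvexMatrixSmooth (M i j) (P.loss i j))
    (hreg : ∀ i, ProperClosedConvex (P.dom i) (P.reg i))
    {v : ∀ i, Fin (m i) → ℝ} (hESO : P.ESO M v) {α : ℝ} (hα : 0 < α) {xs : Fin n → Vec d}
    (hxs : P.IsSolution xs) (s : State n d m) (i : Fin n) :
    ∑ w : Draw n m, P.drawProb w * ‖(P.step α s w).x i - xs i‖ ^ 2
      ≤ ‖s.x i - xs i‖ ^ 2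
        - 2 * α * inner ℝ (s.x i - xs i) ((1 / (P.total : ℝ)) •
            ∑ j, (gradient (P.loss i j) (s.x i) - gradient (P.loss i j) (xs i))
          + (1 / (n : ℝ)) • (P.lam • (s.x i - average s.x) - P.lam • (xs i - average xs)))
        + 2 * α ^ 2 *
          ((1 / ((P.total : ℝ) ^ 2 * (1 - P.pAgg) * P.pClient i) *
              ∑ j, v i j / P.pIndex i j * quadForm (M i j)⁻¹
                (gradient (P.loss i j) (s.x i) - gradient (P.loss i j) (xs i))
            + 1 / ((n : ℝ) ^ 2 * P.pAgg) *
              ‖P.lam • (s.x i - average s.x) - P.lam • (xs i - average xs)‖ ^ 2)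
          + (1 / ((P.total : ℝ) ^ 2 * (1 - P.pAgg) * P.pClient i) *
              ∑ j, v i j / P.pIndex i j * quadForm (M i j)⁻¹
                (s.J i j - gradient (P.loss i j) (xs i))
            + 1 / ((n : ℝ) ^ 2 * P.pAgg) * ‖s.Psi i - P.lam • (xs i - average xs)‖ ^ 2)) := by
  set a := fun j => gradient (P.loss i j) (s.x i) - gradient (P.loss i j) (xs i) with ha
  set b := fun j => s.J i j - gradient (P.loss i j) (xs i) with hb
  set u := P.lam • (s.x i - average s.x) - P.lam • (xs i - average xs) with hu
  set ψ := s.Psi i - P.lam • (xs i - average xs) with hψ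
  have hstep : ∀ w, ‖(P.step α s w).x i - xs i‖ ^ 2
      ≤ ‖(s.x i - xs i) - α • (P.sampled i a u w - P.sampled i b ψ w
        + ((1 / (P.total : ℝ)) • ∑ j, b j + (1 / (n : ℝ)) • ψ))‖ ^ 2 := by
    intro w
    have h1 := norm_prox_sub_le (hreg i) hα (hxs.1 i)
      (fun y hy => hxs.variational hn hsmooth hreg i hy) (s.x i - α • P.estimator s w i)
    rw [← estimator_sub_smoothGradient hp.1,
      show s.x i - xs i - α • (P.estimator s w i - P.smoothGradient xs i)
        = s.x i - α • P.estimator s w i - (xs i - α • P.smoothGradient xs i) by module]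
    exact pow_le_pow_left₀ (norm_nonneg _) h1 2
  refine (Finset.sum_le_sum fun w _ =>
    mul_le_mul_of_nonneg_left (hstep w) (drawProb_nonneg hp hrho w)).trans ?_
  refine (sum_mul_norm_step_sq_le (fun w => drawProb_nonneg hp hrho w) (sum_drawProb hn)
    (sum_drawProb_smul_sampled hp hclient hindex i b ψ)
    (sum_drawProb_smul_sampled hp hclient hindex i a u) (s.x i - xs i) α).trans ?_
  gcongr
  · exact sum_drawProb_mul_norm_sampled_sq_le hn hm hp hclient hindex hM hESO i a u
  · exact sum_drawProb_mul_norm_sampled_sq_le hn hm hp hclient hindex hM hESO i b ψ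

lemma sum_drawProb_mul_quadForm_step_J (α : ℝ) (A : Matrix (Fin d) (Fin d) ℝ) (s : State n d m)
    (i : Fin n) (j : Fin (m i)) (g : Vec d) :
    ∑ w : Draw n m, P.drawProb w * quadForm A ((P.step α s w).J i j - g)
      = (1 - (1 - P.pAgg) * P.pClient i * P.rho i) * quadForm A (s.J i j - g)
        + (1 - P.pAgg) * P.pClient i * P.rho i *
          quadForm A (gradient (P.loss i j) (s.x i) - g) := by
  have hE := sum_drawProb_cases (P := P) i (quadForm A (s.J i j - g)) (quadForm A (s.J i j - g))
    fun _ b => if b then quadForm A (gradient (P.loss i j) (s.x i) - g)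
      else quadForm A (s.J i j - g)
  simp only [smul_eq_mul, ← Finset.sum_mul, sum_toReal_pmf, if_true, Bool.false_eq_true,
    if_false] at hE
  refine Eq.trans (Finset.sum_congr rfl fun w _ => ?_) (hE.trans (by ring))
  congr 1
  rcases w with ⟨ξ, C, S, b⟩
  cases ξ <;> by_cases hC : i ∈ C <;> cases hb : b i <;> simp [step, hC, hb]

lemma sum_drawProb_mul_norm_step_Psi (α : ℝ) (s : State n d m) (i : Fin n) (g : Vec d) :
    ∑ w : Draw n m, P.drawProb w * ‖(P.step α s w).Psi i - g‖ ^ 2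
      = P.pAgg * ‖P.lam • (s.x i - average s.x) - g‖ ^ 2 + (1 - P.pAgg) * ‖s.Psi i - g‖ ^ 2 := by
  have hE := sum_drawProb_cases (P := P) i (‖P.lam • (s.x i - average s.x) - g‖ ^ 2)
    (‖s.Psi i - g‖ ^ 2) fun _ _ => ‖s.Psi i - g‖ ^ 2
  simp only [smul_eq_mul, ← Finset.sum_mul, sum_toReal_pmf, ite_self] at hE
  refine Eq.trans (Finset.sum_congr rfl fun w _ => ?_) (hE.trans (by ring))
  congr 1
  simp only [step]
  split_ifs <;> rfl

/-- The part of the Lyapunov function that belongs to client `i`. -/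
noncomputable def clientLyapunov (P : Data n d m)
    (M : ∀ i, Fin (m i) → Matrix (Fin d) (Fin d) ℝ) (α : ℝ)
    (xs : Fin n → Vec d) (s : State n d m) (i : Fin n) : ℝ :=
  ‖s.x i - xs i‖ ^ 2
    + α * (1 / (2 * (P.total : ℝ) * (1 - P.pAgg) * P.rho i * P.pClient i) *
          ∑ j, quadForm (M i j)⁻¹ (s.J i j - gradient (P.loss i j) (xs i))
        + 1 / (2 * P.pAgg * (n : ℝ) * P.lam) * ‖s.Psi i - P.lam • (xs i - average xs)‖ ^ 2)

lemma lyapunov_eq_sum (M : ∀ i, Fin (m i) → Matrix (Fin d) (Fin d) ℝ) (α : ℝ)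
    (xs : Fin n → Vec d) (s : State n d m) :
    P.lyapunov M α xs s = ∑ i, P.clientLyapunov M α xs s i := by
  simp only [lyapunov, sqDist, clientLyapunov, Finset.sum_add_distrib, ← Finset.mul_sum]

/-- One-step bound for client `i`. The stepsize lets the cocoercivity gain absorb the sampling
noise of the local gradients; what remains are the penalty terms, which only cancel after
summation over all clients. -/
lemma sum_drawProb_mul_clientLyapunov_le (hn : 0 < n) (hm : ∀ i, 0 < m i)
    (hp : 0 < P.pAgg ∧ P.pAgg < 1)
    (hrho : ∀ i, 0 < P.rho i ∧ P.rho i ≤ 1) (hclient : ∀ i, 0 < P.pClient i)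
    (hindex : ∀ i j, 0 < P.pIndex i j) (hlam : 0 ≤ P.lam) {μ : ℝ} (hμ : 0 < μ)
    {M : ∀ i, Fin (m i) → Matrix (Fin d) (Fin d) ℝ} (hM : ∀ i j, (M i j).PosDef)
    (hsmooth : ∀ i j, ConvexMatrixSmooth (M i j) (P.loss i j))
    (hstrong : ∀ i, StrongConvexOn Set.univ μ (P.localLoss i))
    (hreg : ∀ i, ProperClosedConvex (P.dom i) (P.reg i))
    {v : ∀ i, Fin (m i) → ℝ} (hESO : P.ESO M v) {α : ℝ} (hα : 0 < α)
    (hαJ : ∀ i j, α * (4 * (v i j / P.pIndex i j)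
      + (P.total : ℝ) * (μ / (n : ℝ)) * (P.rho i)⁻¹) ≤ (P.total : ℝ) * (1 - P.pAgg) * P.pClient i)
    (hαΨ : α * (4 * P.lam + μ) ≤ P.pAgg * n) {xs : Fin n → Vec d}
    (hxs : P.IsSolution xs) (s : State n d m) (hs : P.lam = 0 → ∀ i, s.Psi i = 0) (i : Fin n) :
    ∑ w : Draw n m, P.drawProb w * P.clientLyapunov M α xs (P.step α s w) i
      ≤ (1 - α * μ / n) * P.clientLyapunov M α xs s i
        - 2 * α / n * inner ℝ (s.x i - xs i)
          (P.lam • (s.x i - average s.x) - P.lam • (xs i - average xs))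
        + (2 * α ^ 2 * (1 / ((n : ℝ) ^ 2 * P.pAgg))
            + α * (1 / (2 * P.pAgg * (n : ℝ) * P.lam)) * P.pAgg) *
          ‖P.lam • (s.x i - average s.x) - P.lam • (xs i - average xs)‖ ^ 2 := by
  have hn' : (0 : ℝ) < n := by positivity
  have hN := P.total_pos hn hm
  have hp0 := hp.1
  have hp1 : 0 < 1 - P.pAgg := sub_pos.2 hp.2
  have hc := hclient i
  have hρ := (hrho i).1
  have hX := sum_drawProb_mul_norm_step_x_sub_sq_le hn hm hp hrho hclient hindex hM hsmooth hreg
    hESO hα hxs s i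
  have hin := le_inner_sum_gradient_sub hn hM hsmooth (hstrong i) (s.x i) (xs i)
  have hΨ := sum_drawProb_mul_norm_step_Psi (P := P) α s i (P.lam • (xs i - average xs))
  have hJ : ∑ w : Draw n m, P.drawProb w * ∑ j,
      quadForm (M i j)⁻¹ ((P.step α s w).J i j - gradient (P.loss i j) (xs i))
      = (1 - (1 - P.pAgg) * P.pClient i * P.rho i) *
          ∑ j, quadForm (M i j)⁻¹ (s.J i j - gradient (P.loss i j) (xs i))
        + (1 - P.pAgg) * P.pClient i * P.rho i * ∑ j, quadForm (M i j)⁻¹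
          (gradient (P.loss i j) (s.x i) - gradient (P.loss i j) (xs i)) := by
    simp only [Finset.mul_sum, ← Finset.sum_add_distrib]
    rw [Finset.sum_comm]
    exact Finset.sum_congr rfl fun j _ => sum_drawProb_mul_quadForm_step_J α _ s i j _
  have hsplit : ∑ w : Draw n m, P.drawProb w * P.clientLyapunov M α xs (P.step α s w) i
      = ∑ w : Draw n m, P.drawProb w * ‖(P.step α s w).x i - xs i‖ ^ 2
        + α * (1 / (2 * (P.total : ℝ) * (1 - P.pAgg) * P.rho i * P.pClient i) *
            ∑ w : Draw n m, P.drawProb w * ∑ j,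
              quadForm (M i j)⁻¹ ((P.step α s w).J i j - gradient (P.loss i j) (xs i))
          + 1 / (2 * P.pAgg * (n : ℝ) * P.lam) * ∑ w : Draw n m,
            P.drawProb w * ‖(P.step α s w).Psi i - P.lam • (xs i - average xs)‖ ^ 2) := by
    rw [Finset.mul_sum, Finset.mul_sum, ← Finset.sum_add_distrib, Finset.mul_sum,
      ← Finset.sum_add_distrib]
    refine Finset.sum_congr rfl fun w _ => ?_
    rw [clientLyapunov]
    ring
  rw [hsplit, hJ, hΨ]
  unfold clientLyapunov
  rw [inner_add_right, real_inner_smul_right _ _ (1 / (n : ℝ))] at hX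
  have hW : P.lam = 0 → ‖s.Psi i - P.lam • (xs i - average xs)‖ ^ 2 = 0 := by
    intro h
    simp [h, hs h i]
  generalize hκ : 1 / ((P.total : ℝ) ^ 2 * (1 - P.pAgg) * P.pClient i) = κ at *
  generalize hcJ : 1 / (2 * (P.total : ℝ) * (1 - P.pAgg) * P.rho i * P.pClient i) = c at *
  have hc0 : 0 < c := by rw [← hcJ]; positivity
  have hθ : c * ((1 - P.pAgg) * P.pClient i * P.rho i) = 1 / (2 * P.total) := by
    rw [← hcJ]; field_simp
  -- the stepsize condition of client `i`, in terms of the weights in use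
  have hcoef : ∀ j, 2 * α * κ * (v i j / P.pIndex i j) + α * μ / n * c ≤ 1 / (2 * P.total) := by
    intro j
    have h1 := mul_le_mul_of_nonneg_left (hαJ i j)
      (by positivity : 0 ≤ 1 / (2 * (P.total : ℝ) ^ 2 * (1 - P.pAgg) * P.pClient i))
    refine le_trans (le_of_eq ?_) (h1.trans (le_of_eq ?_))
    · rw [← hκ, ← hcJ]
      generalize v i j / P.pIndex i j = r
      field_simp
      ring
    · field_simp
  have hcoefA : 2 * α * κ * ∑ j, v i j / P.pIndex i j * quadForm (M i j)⁻¹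
      (gradient (P.loss i j) (s.x i) - gradient (P.loss i j) (xs i))
      ≤ 1 / (2 * P.total) * ∑ j, quadForm (M i j)⁻¹
        (gradient (P.loss i j) (s.x i) - gradient (P.loss i j) (xs i)) := by
    rw [Finset.mul_sum, Finset.mul_sum]
    refine Finset.sum_le_sum fun j _ => ?_
    have h1 : 0 ≤ α * μ / n * c := by positivity
    rw [← mul_assoc]
    exact mul_le_mul_of_nonneg_right (by linarith [hcoef j])
      (quadForm_nonneg (hM i j).inv.posSemidef _)
  have hcoefB : 2 * α * κ * ∑ j, v i j / P.pIndex i j * quadForm (M i j)⁻¹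
      (s.J i j - gradient (P.loss i j) (xs i))
      ≤ (1 / (2 * P.total) - α * μ / n * c) * ∑ j, quadForm (M i j)⁻¹
        (s.J i j - gradient (P.loss i j) (xs i)) := by
    rw [Finset.mul_sum, Finset.mul_sum]
    refine Finset.sum_le_sum fun j _ => ?_
    rw [← mul_assoc]
    exact mul_le_mul_of_nonneg_right (by linarith [hcoef j])
      (quadForm_nonneg (hM i j).inv.posSemidef _)
  -- for `λ = 0` the weight is the junk value `1 / 0 = 0`, and both sides vanish
  have hcoefW : 2 * α * (1 / ((n : ℝ) ^ 2 * P.pAgg)) * ‖s.Psi i - P.lam • (xs i - average xs)‖ ^ 2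
      ≤ 1 / (2 * P.pAgg * (n : ℝ) * P.lam) * (P.pAgg - α * μ / n) *
        ‖s.Psi i - P.lam • (xs i - average xs)‖ ^ 2 := by
    rcases hlam.eq_or_lt with h0 | h0
    · rw [hW h0.symm, mul_zero, mul_zero]
    · refine mul_le_mul_of_nonneg_right ?_ (sq_nonneg _)
      have h1 := mul_le_mul_of_nonneg_left hαΨ
        (by positivity : 0 ≤ 1 / (2 * P.pAgg * (n : ℝ) ^ 2 * P.lam))
      have h2 : 1 / (2 * P.pAgg * (n : ℝ) ^ 2 * P.lam) * (α * (4 * P.lam + μ))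
          = 2 * α * (1 / ((n : ℝ) ^ 2 * P.pAgg))
            + 1 / (2 * P.pAgg * (n : ℝ) * P.lam) * (α * μ / n) := by
        field_simp; ring
      have h3 : 1 / (2 * P.pAgg * (n : ℝ) ^ 2 * P.lam) * (P.pAgg * n)
          = 1 / (2 * P.pAgg * (n : ℝ) * P.lam) * P.pAgg := by field_simp
      linarith
  -- abstracting the nonlinear quantities leaves a linear combination of these bounds
  have hA := mul_le_mul_of_nonneg_left hcoefA hα.le
  have hB := mul_le_mul_of_nonneg_left hcoefB hα.le
  have hΨ' := mul_le_mul_of_nonneg_left hcoefW hα.le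
  have hG := mul_le_mul_of_nonneg_left hin (by positivity : 0 ≤ 2 * α)
  generalize 1 / (2 * P.pAgg * (n : ℝ) * P.lam) = cΨ at *
  generalize 1 / ((n : ℝ) ^ 2 * P.pAgg) = cU at *
  generalize inner ℝ (s.x i - xs i)
    (P.lam • (s.x i - average s.x) - P.lam • (xs i - average xs)) = yu at *
  generalize ‖P.lam • (s.x i - average s.x) - P.lam • (xs i - average xs)‖ ^ 2 = U at *
  generalize (1 - P.pAgg) * P.pClient i * P.rho i = θ at *
  generalize ∑ j, quadForm (M i j)⁻¹
    (gradient (P.loss i j) (s.x i) - gradient (P.loss i j) (xs i)) = A at *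
  generalize ∑ j, quadForm (M i j)⁻¹ (s.J i j - gradient (P.loss i j) (xs i)) = B at *
  have hθA := congrArg (fun r => α * r * A) hθ
  have hθB := congrArg (fun r => α * r * B) hθ
  simp only [div_eq_mul_inv, mul_inv, one_mul] at hX hA hB hΨ' hG hθA hθB ⊢
  linarith

/-- One iteration contracts the mean of the Lyapunov function by the factor `1 - α μ / n`. For
`λ = 0` the control variates of the penalty have to vanish, since their weight does. -/
lemma sum_drawProb_mul_lyapunov_step_le (hn : 0 < n) (hm : ∀ i, 0 < m i)
    (hp : 0 < P.pAgg ∧ P.pAgg < 1)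
    (hrho : ∀ i, 0 < P.rho i ∧ P.rho i ≤ 1) (hclient : ∀ i, 0 < P.pClient i)
    (hindex : ∀ i j, 0 < P.pIndex i j) (hlam : 0 ≤ P.lam) {μ : ℝ} (hμ : 0 < μ)
    {M : ∀ i, Fin (m i) → Matrix (Fin d) (Fin d) ℝ} (hM : ∀ i j, (M i j).PosDef)
    (hsmooth : ∀ i j, ConvexMatrixSmooth (M i j) (P.loss i j))
    (hstrong : ∀ i, StrongConvexOn Set.univ μ (P.localLoss i))
    (hreg : ∀ i, ProperClosedConvex (P.dom i) (P.reg i))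
    {v : ∀ i, Fin (m i) → ℝ} (hESO : P.ESO M v) {α : ℝ} (hα : 0 < α)
    (hαJ : ∀ i j, α * (4 * (v i j / P.pIndex i j)
      + (P.total : ℝ) * (μ / (n : ℝ)) * (P.rho i)⁻¹) ≤ (P.total : ℝ) * (1 - P.pAgg) * P.pClient i)
    (hαΨ : α * (4 * P.lam + μ) ≤ P.pAgg * n) {xs : Fin n → Vec d}
    (hxs : P.IsSolution xs) (s : State n d m) (hs : P.lam = 0 → ∀ i, s.Psi i = 0) :
    ∑ w : Draw n m, P.drawProb w * P.lyapunov M α xs (P.step α s w)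
      ≤ (1 - α * μ / n) * P.lyapunov M α xs s := by
  have hn' : (0 : ℝ) < n := by positivity
  have hp0 := hp.1
  simp only [lyapunov_eq_sum, Finset.mul_sum]
  rw [Finset.sum_comm]
  have hbound := Finset.sum_le_sum fun i (_ : i ∈ Finset.univ) =>
    sum_drawProb_mul_clientLyapunov_le hn hm hp hrho hclient hindex hlam hμ hM hsmooth hstrong hreg
      hESO hα hαJ hαΨ hxs s hs i
  simp only [Finset.sum_add_distrib, Finset.sum_sub_distrib, ← Finset.mul_sum] at hbound
  simp only [← Finset.mul_sum]
  refine hbound.trans ?_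
  -- the penalty gradient is `λ` times a projection, so its inner product with the displacement
  -- is its squared norm divided by `λ`
  have hproj : P.lam * ∑ i, inner ℝ (s.x i - xs i)
      (P.lam • (s.x i - average s.x) - P.lam • (xs i - average xs))
      = ∑ i, ‖P.lam • (s.x i - average s.x) - P.lam • (xs i - average xs)‖ ^ 2 := by
    have hy : ∀ i, P.lam • (s.x i - average s.x) - P.lam • (xs i - average xs)
        = P.lam • ((s.x i - xs i) - average fun k => s.x k - xs k) := by
      intro i
      rw [average_sub]
      module
    have h1 := sum_inner_sub_average hn (fun i => s.x i - xs i) (fun i => s.x i - xs i)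
    simp only [hy, real_inner_smul_right, norm_smul, mul_pow, Real.norm_eq_abs, sq_abs,
      ← Finset.mul_sum]
    simp only [real_inner_self_eq_norm_sq] at h1
    rw [h1]
    simp only [real_inner_comm (_ - _) (s.x _ - xs _)]
    ring
  rcases hlam.eq_or_lt with h0 | h0
  · -- without a penalty all remaining terms carry a factor `λ`
    simp [← h0]
  have hU0 : 0 ≤ ∑ i, ‖P.lam • (s.x i - average s.x) - P.lam • (xs i - average xs)‖ ^ 2 := by
    positivity
  generalize ∑ i, ‖P.lam • (s.x i - average s.x) - P.lam • (xs i - average xs)‖ ^ 2 = U at *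
  have hyu : ∑ i, inner ℝ (s.x i - xs i)
      (P.lam • (s.x i - average s.x) - P.lam • (xs i - average xs)) = U / P.lam := by
    rw [← hproj]; field_simp
  rw [hyu]
  have hcoef : 2 * α ^ 2 * (1 / ((n : ℝ) ^ 2 * P.pAgg))
      + α * (1 / (2 * P.pAgg * (n : ℝ) * P.lam)) * P.pAgg ≤ 2 * α / n * (1 / P.lam) := by
    have h1 : α * (4 * P.lam) ≤ P.pAgg * n := by nlinarith
    have h2 := mul_le_mul_of_nonneg_left h1
      (by positivity : 0 ≤ α * (1 / (2 * (n : ℝ) ^ 2 * P.pAgg * P.lam)))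
    have h3 : α * (1 / (2 * (n : ℝ) ^ 2 * P.pAgg * P.lam)) * (α * (4 * P.lam))
        = 2 * α ^ 2 * (1 / ((n : ℝ) ^ 2 * P.pAgg)) := by field_simp; ring
    have h4 : α * (1 / (2 * (n : ℝ) ^ 2 * P.pAgg * P.lam)) * (P.pAgg * n)
        = 1 / 4 * (2 * α / n * (1 / P.lam)) := by field_simp; ring
    have h5 : α * (1 / (2 * P.pAgg * (n : ℝ) * P.lam)) * P.pAgg
        = 1 / 4 * (2 * α / n * (1 / P.lam)) := by field_simp; ring
    have h6 : 0 ≤ 2 * α / n * (1 / P.lam) := by positivity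
    linarith
  have h7 := mul_le_mul_of_nonneg_right hcoef hU0
  have h8 : 2 * α / n * (U / P.lam) = 2 * α / n * (1 / P.lam) * U := by ring
  linarith

/-! ### Iterating -/

lemma expect_succ (α : ℝ) (x0 : Fin n → Vec d) (k : ℕ) (φ : State n d m → ℝ) :
    P.expect α x0 (k + 1) φ
      = P.expect α x0 k fun s => ∑ w, P.drawProb w * φ (P.step α s w) := by
  unfold expect
  rw [← (Fin.snocEquiv fun _ : Fin (k + 1) => Draw n m).sum_comp, Fintype.sum_prod_type,
    Finset.sum_comm]
  refine Finset.sum_congr rfl fun ω _ => ?_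
  rw [Finset.mul_sum]
  refine Finset.sum_congr rfl fun w _ => ?_
  simp only [Fin.snocEquiv_apply, Fin.prod_univ_castSucc, Fin.snoc_castSucc, Fin.snoc_last, run]
  ring

/-- Without a penalty, every iterate meets the side condition of the one-step bound. -/
lemma run_Psi_eq_zero (hlam : P.lam = 0) (α : ℝ) (x0 : Fin n → Vec d) (k : ℕ)
    (ω : Fin k → Draw n m) (i : Fin n) : (P.run α x0 k ω).Psi i = 0 := by
  induction k with
  | zero => rfl
  | succ k ih => simp [run, step, hlam, ih]

lemma expect_mono (hp : 0 < P.pAgg ∧ P.pAgg < 1) (hrho : ∀ i, 0 < P.rho i ∧ P.rho i ≤ 1) {α : ℝ}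
    {x0 : Fin n → Vec d} {k : ℕ} {φ χ : State n d m → ℝ}
    (h : ∀ ω, φ (P.run α x0 k ω) ≤ χ (P.run α x0 k ω)) :
    P.expect α x0 k φ ≤ P.expect α x0 k χ :=
  Finset.sum_le_sum fun ω _ => mul_le_mul_of_nonneg_left (h ω)
    (Finset.prod_nonneg fun _ _ => drawProb_nonneg hp hrho _)

lemma expect_const_mul (α : ℝ) (x0 : Fin n → Vec d) (k : ℕ) (r : ℝ) (φ : State n d m → ℝ) :
    P.expect α x0 k (fun s => r * φ s) = r * P.expect α x0 k φ := by
  simp only [expect, Finset.mul_sum]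
  exact Finset.sum_congr rfl fun ω _ => by ring

lemma sqDist_le_lyapunov (hp : 0 < P.pAgg ∧ P.pAgg < 1)
    (hrho : ∀ i, 0 < P.rho i ∧ P.rho i ≤ 1) (hclient : ∀ i, 0 < P.pClient i) (hlam : 0 ≤ P.lam)
    {M : ∀ i, Fin (m i) → Matrix (Fin d) (Fin d) ℝ} (hM : ∀ i j, (M i j).PosDef) {α : ℝ}
    (hα : 0 < α) (xs : Fin n → Vec d) (s : State n d m) :
    sqDist xs s ≤ P.lyapunov M α xs s := by
  have hp0 := hp.1
  have hp1 : 0 < 1 - P.pAgg := sub_pos.2 hp.2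
  have h1 : 0 ≤ ∑ i, 1 / (2 * (P.total : ℝ) * (1 - P.pAgg) * P.rho i * P.pClient i) *
      ∑ j, quadForm (M i j)⁻¹ (s.J i j - gradient (P.loss i j) (xs i)) := by
    refine Finset.sum_nonneg fun i _ => mul_nonneg ?_ (Finset.sum_nonneg fun j _ =>
      quadForm_nonneg (hM i j).inv.posSemidef _)
    have := hclient i
    have := (hrho i).1
    positivity
  have h2 : 0 ≤ 1 / (2 * P.pAgg * (n : ℝ) * P.lam) *
      ∑ i, ‖s.Psi i - P.lam • (xs i - average xs)‖ ^ 2 := by positivity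
  unfold lyapunov
  nlinarith

end Data

end L2SGD

theorem mainTheorem9 {n d : ℕ} {m : Fin n → ℕ} (hn : 0 < n) (hd : 0 < d) (hm : ∀ i, 0 < m i)
    (P : L2SGD.Data n d m)
    (hp : 0 < P.pAgg ∧ P.pAgg < 1)
    (hrho : ∀ i, 0 < P.rho i ∧ P.rho i ≤ 1)
    (hclient : ∀ i, 0 < P.pClient i)
    (hindex : ∀ i j, 0 < P.pIndex i j)
    (hlam : 0 ≤ P.lam)
    (μ : ℝ) (hμ : 0 < μ)
    (M : ∀ i, Fin (m i) → Matrix (Fin d) (Fin d) ℝ)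
    (hM : ∀ i j, (M i j).PosDef)
    (hsmooth : ∀ i j, L2SGD.ConvexMatrixSmooth (M i j) (P.loss i j))
    (hstrong : ∀ i, StrongConvexOn Set.univ μ (P.localLoss i))
    (hreg : ∀ i, L2SGD.ProperClosedConvex (P.dom i) (P.reg i))
    (v : ∀ i, Fin (m i) → ℝ)
    (hESO : P.ESO M v)
    (α : ℝ) (hα : α = P.stepsize μ v) :
    0 < α ∧
    ∃ xs : Fin n → L2SGD.Vec d,
      P.IsSolution xs ∧ (∀ y, P.IsSolution y → y = xs) ∧
      ∀ x0 : Fin n → L2SGD.Vec d,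
        (∀ k : ℕ, P.expect α x0 k (P.lyapunov M α xs) ≤
          (1 - α * μ / (n : ℝ)) ^ k * P.lyapunov M α xs (P.start x0)) ∧
        ∀ ε : ℝ, 0 < ε → ε < 1 → ∀ k : ℕ, P.complexity μ v * Real.log (1 / ε) ≤ (k : ℝ) →
          P.expect α x0 k (P.lyapunov M α xs) ≤ ε * P.lyapunov M α xs (P.start x0) ∧
          P.expect α x0 k (L2SGD.Data.sqDist xs) ≤
            ε * P.lyapunov M α xs (P.start x0) := by
  have hv : ∀ i j, 0 ≤ v i j := hESO.v_nonneg hd hindex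
  have hα0 : 0 < α := hα ▸ L2SGD.Data.stepsize_pos hn hm hp hrho hclient hindex hlam hμ hv
  have hαJ := L2SGD.Data.stepsize_mul_le hn hm hrho hindex hμ hv
  have hαΨ := L2SGD.Data.stepsize_mul_le_pAgg_mul (v := v) hlam hμ
  have hcomp := L2SGD.Data.one_le_complexity_mul hn hm hp hrho hclient hindex hlam hμ hv
  rw [← hα] at hαJ hαΨ hcomp
  have hn' : (0 : ℝ) < n := by positivity
  have hrate : 0 ≤ 1 - α * μ / n := by
    have h1 : α * μ ≤ n := by nlinarith [hp.2, mul_nonneg hα0.le hlam]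
    linarith [(div_le_one hn').2 h1]
  refine ⟨hα0, ?_⟩
  obtain ⟨xs, hxs, huniq⟩ := L2SGD.Data.exists_isSolution hn hμ hlam hsmooth hstrong hreg
  refine ⟨xs, hxs, huniq, fun x0 => ?_⟩
  have hlin : ∀ k : ℕ, P.expect α x0 k (P.lyapunov M α xs) ≤
      (1 - α * μ / (n : ℝ)) ^ k * P.lyapunov M α xs (P.start x0) := by
    intro k
    induction k with
    | zero => simp [L2SGD.Data.expect, L2SGD.Data.run]
    | succ k ih =>
      rw [L2SGD.Data.expect_succ, pow_succ', mul_assoc]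
      refine (L2SGD.Data.expect_mono hp hrho
        (χ := fun s => (1 - α * μ / (n : ℝ)) * P.lyapunov M α xs s) fun ω =>
        L2SGD.Data.sum_drawProb_mul_lyapunov_step_le hn hm hp hrho hclient hindex hlam hμ hM
          hsmooth hstrong hreg hESO hα0 hαJ hαΨ hxs _
          fun h => L2SGD.Data.run_Psi_eq_zero h α x0 k ω).trans ?_
      rw [L2SGD.Data.expect_const_mul]
      exact mul_le_mul_of_nonneg_left ih hrate
  refine ⟨hlin, fun ε hε hε1 k hk => ?_⟩
  have hle := L2SGD.Data.sqDist_le_lyapunov hp hrho hclient hlam hM hα0 xs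
  have hΦ0 : 0 ≤ P.lyapunov M α xs (P.start x0) :=
    (Finset.sum_nonneg fun i _ => sq_nonneg _).trans (hle _)
  have hpow : (1 - α * μ / (n : ℝ)) ^ k ≤ ε := by
    have hγ : 0 ≤ α * μ / n := by positivity
    have hlog : 0 ≤ Real.log (1 / ε) := Real.log_nonneg (by rw [le_div_iff₀ hε]; linarith)
    have h1 : Real.log (1 / ε) ≤ k * (α * μ / n) := by
      calc Real.log (1 / ε) ≤ P.complexity μ v * (α * μ / n) * Real.log (1 / ε) :=
            le_mul_of_one_le_left hlog hcomp
        _ = P.complexity μ v * Real.log (1 / ε) * (α * μ / n) := by ring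
        _ ≤ k * (α * μ / n) := mul_le_mul_of_nonneg_right hk hγ
    calc (1 - α * μ / (n : ℝ)) ^ k ≤ Real.exp (-(α * μ / n)) ^ k :=
          pow_le_pow_left₀ hrate (Real.one_sub_le_exp_neg _) k
      _ = Real.exp (-(k * (α * μ / n))) := by rw [← Real.exp_nat_mul]; congr 1; ring
      _ ≤ Real.exp (-Real.log (1 / ε)) := Real.exp_le_exp.2 (neg_le_neg h1)
      _ = ε := by rw [one_div, Real.log_inv, neg_neg, Real.exp_log hε]
  have hfin : P.expect α x0 k (P.lyapunov M α xs) ≤ ε * P.lyapunov M α xs (P.start x0) :=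
    (hlin k).trans (mul_le_mul_of_nonneg_right hpow hΦ0)
  exact ⟨hfin, (L2SGD.Data.expect_mono hp hrho fun ω => hle _).trans hfin⟩
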